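/- Let $n\ge 3$, $k\ge 1$ and let $\tau=2k-1$ or $\tau=2k$. A spherical $\tau$-design is a nonempty finite set $C\subset\mathbb S^{n-1}$ over which every polynomial in $n$ variables of total degree at most $\tau$ has the same average as over $\mathbb S^{n-1}$ (with its surface measure). Put $$D(n,2k-1)=2\binom{n+k-2}{n-1},\qquad D(n,2k)=\binom{n+k-1}{n-1}+\binom{n+k-2}{n-1}.$$ Let $P_i^{(n)}$ be the Gegenbauer polynomials, $P_0^{(n)}=1$, $P_1^{(n)}=t$, $(i+n-2)P_{i+1}^{(n)}=(2i+n-2)\,t\,P_i^{(n)}-i\,P_{i-1}^{(n)}$ for $i\ge 1$, and let $P_i^{a,b}$ ($a,b\in\{0,1\}$) be the Jacobi polynomial of degree $i$ with parameters $\left(a+\frac{n-3}2,\,b+\frac{n-3}2\right)$, normalized by $P_i^{a,b}(1)=1$. Let $t_{i,1}^{a,b}<\dots<t_{i,i}^{a,b}$ be its zeros and $t_i^{a,b}=t_{i,i}^{a,b}$ the largest one, with $t_0^{a,b}:=-1$. Define $$L_{2k-1}(n,s)=\binom{k+n-3}{k-1}\left[\frac{2k+n-3}{n-1}-\frac{P^{(n)}_{k-1}(s)-P^{(n)}_k(s)}{(1-s)P^{(n)}_k(s)}\right],\quad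 s\in[t_{k-1}^{1,1},t_k^{1,0}],$$ $$L_{2k}(n,s)=\binom{k+n-2}{k}\left[\frac{2k+n-1}{n-1}-\frac{(1+s)\left(P^{(n)}_k(s)-P^{(n)}_{k+1}(s)\right)}{(1-s)\left(P^{(n)}_k(s)+P^{(n)}_{k+1}(s)\right)}\right],\quad s\in[t_k^{1,0},t_k^{1,1}].$$ Let $M$ be an integer with $D(n,\tau)<M<D(n,\tau+1)$, and let $s$ be the solution of $L_\tau(n,s)=M$ in the interval given above. For a polynomial $f$ let $f_0=\int_{-1}^1 f(t)(1-t^2)^{(n-3)/2}\,dt\Big/\int_{-1}^1(1-t^2)^{(n-3)/2}\,dt$. The nodes and weights of Levenshtein's $1/M$-quadrature rule are as follows. If $\tau=2k-1$, then $\alpha_0<\dots<\alpha_{k-1}=s$ are the roots in $t$ of $P_k^{1,0}(t)P_{k-1}^{1,0}(s)=P_k^{1,0}(s)P_{k-1}^{1,0}(t)$, and $\rho_0,\dots,\rho_{k-1}$ are the weights for which $f_0=\frac{f(1)}M+\sum_{i=0}^{k-1}\rho_i f(\alpha_i)$ for all polynomials $f$ of degree at most $2k-1$. If $\tau=2k$,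 then $\beta_0=-1$, $\beta_1<\dots<\beta_k=s$ are the roots in $t$ of $P_k^{1,1}(t)P_{k-1}^{1,1}(s)=P_k^{1,1}(s)P_{k-1}^{1,1}(t)$, and $\gamma_0,\dots,\gamma_k$ are the weights for which $f_0=\frac{f(1)}M+\sum_{i=0}^{k}\gamma_i f(\beta_i)$ for all polynomials $f$ of degree at most $2k$. (Equivalently, the weight of a node is $\ell_0$, where $\ell$ is the Lagrange basis polynomial of that node for the set of all nodes together with $1$.) Let $h:[-1,1]\to[0,+\infty]$ be absolutely monotone: on $[-1,1)$ it is finite and smooth with $h^{(j)}\ge 0$ for all $j\ge 0$. For a finite set $C\subset\mathbb S^{n-1}$ let $E(n,C;h)=\sum_{x,y\in C,\,x\ne y}h(\langle x,y\rangle)$, and let $$\mathcal U(n,M,\tau;h)=\sup\{E(n,C;h): C\subset\mathbb S^{n-1}\text{ is a }\tau\text{-design},\ |C|=M\}$$ (with $\sup\emptyset=-\infty$). Let $u\in[-1,1)$ be such that $\langle x,y\rangle\le u$ for all distinct points $x,y$ of every $\tau$-design with $M$ points on $\mathbb S^{n-1}$. Let $g$ be a real polynomial of degree at most $\tau$ that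 interpolates $h$ as follows: if $\tau=2k-1$, $$g(-1)=h(-1),\quad g(u)=h(u),\quad g(t_{k-1,i}^{1,1})=h(t_{k-1,i}^{1,1}),\quad g'(t_{k-1,i}^{1,1})=h'(t_{k-1,i}^{1,1})\quad(1\le i\le k-1);$$ if $\tau=2k$, $$g(u)=h(u),\quad g(t_{k,i}^{1,0})=h(t_{k,i}^{1,0}),\quad g'(t_{k,i}^{1,0})=h'(t_{k,i}^{1,0})\quad(1\le i\le k).$$ Then $$\frac{\mathcal U(n,M,\tau;h)}{M^2}\le\begin{cases}\dfrac{\mathrm{ULB}}{M^2}+\displaystyle\sum_{i=0}^{k-1}\rho_i\left(g(\alpha_i)-h(\alpha_i)\right),&\tau=2k-1,\\[8pt]\dfrac{\mathrm{ULB}}{M^2}+\displaystyle\sum_{i=0}^{k}\gamma_i\left(g(\beta_i)-h(\beta_i)\right),&\tau=2k,\end{cases}$$ where $\mathrm{ULB}=M^2\sum_{i=0}^{k-1}\rho_i h(\alpha_i)$ if $\tau=2k-1$ and $\mathrm{ULB}=M^2\sum_{i=0}^{k}\gamma_i h(\beta_i)$ if $\tau=2k$. -/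

import Mathlib

open MeasureTheory Polynomial
open scoped ENNReal

noncomputable section

namespace SphericalDesign

/-- The unit sphere of `ℝⁿ`. -/
abbrev Sph (n : ℕ) : Type := Metric.sphere (0 : EuclideanSpace ℝ (Fin n)) 1

/-- A spherical `τ`-design: a nonempty finite set of points of the unit sphere over which every
polynomial in `n` variables of total degree at most `τ` has the same average as over the whole
sphere with its surface measure. -/
def IsDesign {n : ℕ} (τ : ℕ) (C : Finset (Sph n)) : Prop :=
  C.Nonempty ∧ ∀ p : MvPolynomial (Fin n) ℝ, p.totalDegree ≤ τ →
    ⨍ x : Sph n, MvPolynomial.eval (fun i => x.1 i) p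
        ∂((volume : Measure (EuclideanSpace ℝ (Fin n))).toSphere)
      = (∑ x ∈ C, MvPolynomial.eval (fun i => x.1 i) p) / (C.card : ℝ)

/-- The `h`-energy: the sum of `h ⟨x, y⟩` over ordered pairs of distinct points. -/
def energy {n : ℕ} (h : ℝ → ℝ≥0∞) (C : Finset (Sph n)) : ℝ≥0∞ :=
  ∑ p ∈ C.offDiag, h (inner ℝ p.1.1 p.2.1)

/-- `𝒰(n, M, τ; h)`, the supremum of the `h`-energies of the `τ`-designs with `M` points
(`-∞` if there is no such design). -/
def maxEnergy (n M τ : ℕ) (h : ℝ → ℝ≥0∞) : EReal :=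
  ⨆ (C : Finset (Sph n)) (_ : IsDesign τ C) (_ : C.card = M), ((energy h C : ℝ≥0∞) : EReal)

/-- `u(n, M, τ)`, the supremum of the inner products of distinct points of `τ`-designs with `M`
points (`-∞` if there is no such design). -/
def maxInner (n M τ : ℕ) : EReal :=
  ⨆ (C : Finset (Sph n)) (_ : IsDesign τ C) (_ : C.card = M) (p ∈ C.offDiag),
    ((inner ℝ p.1.1 p.2.1 : ℝ) : EReal)

/-- A potential `h : [-1, 1] → [0, ∞]` (extended to `ℝ` in any way) is absolutely monotone: on
`[-1, 1)` it is finite and smooth with all derivatives nonnegative. -/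
def AbsMonotone (h : ℝ → ℝ≥0∞) : Prop :=
  (∀ t ∈ Set.Ico (-1 : ℝ) 1, h t ≠ ∞) ∧
    AbsolutelyMonotoneOn (fun t => (h t).toReal) (Set.Ico (-1 : ℝ) 1)

/-- The Delsarte-Goethals-Seidel number `D(n, τ)`. -/
def dgs (n τ : ℕ) : ℕ :=
  if Even τ then
    (n + τ / 2 - 1).choose (n - 1) + (n + τ / 2 - 2).choose (n - 1)
  else 2 * (n + (τ + 1) / 2 - 2).choose (n - 1)

/-- The normalized Gegenbauer polynomials `P_i^{(n)}`, by their three-term recurrence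
`(i + n - 2) P_{i+1} = (2 i + n - 2) t P_i - i P_{i-1}` for `i ≥ 1`. -/
def gegenbauer (n : ℕ) : ℕ → ℝ[X]
  | 0 => 1
  | 1 => X
  | i + 2 =>
      C ((2 * ((i : ℝ) + 1) + n - 2) / ((i : ℝ) + 1 + n - 2)) * X * gegenbauer n (i + 1)
        - C (((i : ℝ) + 1) / ((i : ℝ) + 1 + n - 2)) * gegenbauer n i

/-- The Jacobi polynomial of degree `i` with parameters `(a, b)`, divided by its value at `1`,
i.e. the hypergeometric polynomial `₂F₁(-i, i + a + b + 1; a + 1; (1 - t) / 2)`. -/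
def jacobi (a b : ℝ) (i : ℕ) : ℝ[X] :=
  ∑ j ∈ Finset.range (i + 1),
    C ((-1) ^ j * (i.choose j : ℝ) * (ascPochhammer ℝ j).eval ((i : ℝ) + a + b + 1)
        / (ascPochhammer ℝ j).eval (a + 1)) * (C (1 / 2) * (1 - X)) ^ j

/-- The adjacent polynomials `P_i^{a,b}`: the Jacobi polynomials with parameters
`(a + (n - 3) / 2, b + (n - 3) / 2)`, normalized to be `1` at `1`. -/
def adj (n a b i : ℕ) : ℝ[X] :=
  jacobi ((a : ℝ) + ((n : ℝ) - 3) / 2) ((b : ℝ) + ((n : ℝ) - 3) / 2) i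

/-- The set of the zeros `t_{i,1}^{a,b} < ⋯ < t_{i,i}^{a,b}` of `P_i^{a,b}`. -/
def adjRoots (n a b i : ℕ) : Finset ℝ := (adj n a b i).roots.toFinset

/-- The largest zero `t_i^{a,b}` of `P_i^{a,b}`; it is `-1` by convention for `i = 0` (all the
zeros lie in `(-1, 1)`). -/
def lastRoot (n a b i : ℕ) : ℝ :=
  (insert (-1) (adjRoots n a b i)).max' (Finset.insert_nonempty _ _)

/-- The Levenshtein function `L_{2k-1}(n, s)`. -/
def levOdd (n k : ℕ) (s : ℝ) : ℝ :=
  ((k + n - 3).choose (k - 1) : ℝ) *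
    ((2 * (k : ℝ) + n - 3) / ((n : ℝ) - 1)
      - ((gegenbauer n (k - 1)).eval s - (gegenbauer n k).eval s)
          / ((1 - s) * (gegenbauer n k).eval s))

/-- The Levenshtein function `L_{2k}(n, s)`. -/
def levEven (n k : ℕ) (s : ℝ) : ℝ :=
  ((k + n - 2).choose k : ℝ) *
    ((2 * (k : ℝ) + n - 1) / ((n : ℝ) - 1)
      - ((1 + s) * ((gegenbauer n k).eval s - (gegenbauer n (k + 1)).eval s))
          / ((1 - s) * ((gegenbauer n k).eval s + (gegenbauer n (k + 1)).eval s)))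

/-- The zeroth Gegenbauer coefficient `f₀`, i.e. the mean of `f` on `[-1, 1]` with respect to the
weight `(1 - t²)^{(n-3)/2}`. -/
def gegenbauerCoeffZero (n : ℕ) (f : ℝ[X]) : ℝ :=
  (∫ t in (-1 : ℝ)..1, f.eval t * (1 - t ^ 2) ^ (((n : ℝ) - 3) / 2))
    / ∫ t in (-1 : ℝ)..1, (1 - t ^ 2) ^ (((n : ℝ) - 3) / 2)

/-- The polynomial `P_k(t) P_{k-1}(s) - P_k(s) P_{k-1}(t)` in `t`, where `P_i = P_i^{1,b}`. -/
def nodePoly (n b k : ℕ) (s : ℝ) : ℝ[X] :=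
  C ((adj n 1 b (k - 1)).eval s) * adj n 1 b k
    - C ((adj n 1 b k).eval s) * adj n 1 b (k - 1)

/-- The set of Levenshtein nodes `α₀ < ⋯ < α_{k-1} = s` for `τ = 2k - 1`. -/
def nodesOdd (n k : ℕ) (s : ℝ) : Finset ℝ := (nodePoly n 0 k s).roots.toFinset

/-- The set of Levenshtein nodes `-1 = β₀ < β₁ < ⋯ < β_k = s` for `τ = 2k`. -/
def nodesEven (n k : ℕ) (s : ℝ) : Finset ℝ := insert (-1) (nodePoly n 1 k s).roots.toFinset

/-- The weight at the node `a ∈ T` of the quadrature rule for `f₀` with nodes `T ∪ {1}`: the value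
of the functional `f ↦ f₀` on the Lagrange basis polynomial of `a`. A rule with these nodes that is
exact in degrees up to the number of elements of `T` can have no other weights, so for the
Levenshtein nodes these are the weights `ρᵢ`, `γᵢ` of Levenshtein's rule. -/
def weight (n : ℕ) (T : Finset ℝ) (a : ℝ) : ℝ :=
  gegenbauerCoeffZero n (Lagrange.basis (insert 1 T) id a)

/-- The universal lower bound `M² ∑ ρᵢ h(αᵢ)` attached to the nodes `T`. -/
def ulb (n M : ℕ) (T : Finset ℝ) (h : ℝ → ℝ≥0∞) : ℝ :=
  (M : ℝ) ^ 2 * ∑ a ∈ T, weight n T a * (h a).toReal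

/-- `g` agrees with `h` at the points of `S`, and to first order at the points of `T`. -/
def Interpolates (h : ℝ → ℝ≥0∞) (S T : Finset ℝ) (g : ℝ[X]) : Prop :=
  (∀ t ∈ S, g.eval t = (h t).toReal) ∧
    ∀ t ∈ T, g.eval t = (h t).toReal ∧
      g.derivative.eval t = deriv (fun x => (h x).toReal) t

end SphericalDesign

end

/-! For a `τ`-design `D` with `M` points and a polynomial `g` of degree at most `τ`, the sum of `g
⟨x, y⟩` over distinct pairs depends only on `M`: it is `M² g₀ - M g(1)`. So if `h ≤ g` on `[-1, u]`,
every energy is at most `M² (g₀ - g(1)/M)`. Levenshtein's rule turns `g₀ - g(1)/M` into the weighted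
sum of the values of `g` at the nodes, which is the claimed bound once the universal lower bound
cancels against the sum of the `h`-terms.

The majorization is the error formula of Hermite interpolation: `h - g = κ ω` with `κ ≥ 0`, since a
derivative of `h` is nonnegative, and `ω` is `(t + 1)(t - u)` or `t - u` times a square, hence `≤ 0`
on `[-1, u]` (`AbsMonotone.exists_sub_eq_mul_hermiteNodal`). The formula needs distinct nodes. This
follows from `M > D(n, τ)`: if `u` met another node, a linear programming polynomial would force `M
≤ D(n, τ)`.

The rule itself (`quadrature_nodesOdd`, `quadrature_nodesEven`) holds because the node polynomial
`Q` is quasi-orthogonal: its zeros are real and simple, and interpolatory quadrature is exact up to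
degree `τ`. Testing on `Q` or `(1 + X) Q` gives the weight at `1`, and `L_τ(n, s) = M` says exactly
that it is `1/M`. The computations rest on contiguous relations of hypergeometric polynomials and on
the means `1/D(n, 2k)` of `P_k^{1,0}` and `2/D(n, 2k+1)` of `(1 + t) P_k^{1,1}`. -/

noncomputable section

namespace SphericalDesign

variable {n : ℕ}

/-! ### Contiguous relations of terminating hypergeometric polynomials -/

/-- The coefficients of the terminating hypergeometric series `₂F₁(-j, j + c; a; y)`. -/
def hypCoeff (c a : ℝ) (j i : ℕ) : ℝ :=
  (-1) ^ i * (j.choose i : ℝ) * (ascPochhammer ℝ i).eval ((j : ℝ) + c)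
    / (ascPochhammer ℝ i).eval a

/-- The terminating hypergeometric series `₂F₁(-j, j + c; a; y)` as a polynomial in `y`. -/
def hypPoly (c a : ℝ) (j : ℕ) : ℝ[X] :=
  ∑ i ∈ Finset.range (j + 1), monomial i (hypCoeff c a j i)

theorem coeff_hypPoly (c a : ℝ) (j i : ℕ) : (hypPoly c a j).coeff i = hypCoeff c a j i := by
  simp only [hypPoly, finsetSum_coeff, coeff_monomial, Finset.sum_ite_eq', Finset.mem_range]
  split_ifs with h
  · rfl
  · simp [hypCoeff, Nat.choose_eq_zero_of_lt (by lia : j < i)]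

theorem jacobi_eq_comp (a b : ℝ) (j : ℕ) :
    jacobi a b j = (hypPoly (a + b + 1) (a + 1) j).comp (C (1 / 2) * (1 - X)) := by
  simp only [jacobi, hypPoly, Polynomial.sum_comp, monomial_comp, hypCoeff, add_assoc]

theorem ascPochhammer_eval_succ_left (x : ℝ) (i : ℕ) :
    (ascPochhammer ℝ (i + 1)).eval x = x * (ascPochhammer ℝ i).eval (x + 1) := by
  simp [ascPochhammer_succ_left, eval_comp]

theorem ascPochhammer_eval_succ_right (x : ℝ) (i : ℕ) :
    (ascPochhammer ℝ (i + 1)).eval x = (ascPochhammer ℝ i).eval x * (x + i) := by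
  simp [ascPochhammer_succ_right]

theorem choose_succ_mul_real (j i : ℕ) :
    (j.choose (i + 1) : ℝ) * (i + 1) = j.choose i * ((j : ℝ) - i) := by
  rcases le_or_gt i j with h | h
  · have := Nat.choose_succ_right_eq j i
    rw [← Nat.cast_sub h]
    exact_mod_cast this
  · rw [Nat.choose_eq_zero_of_lt h, Nat.choose_eq_zero_of_lt (by lia)]
    simp

theorem choose_succ_succ_mul_real (j i : ℕ) :
    ((j + 1).choose (i + 1) : ℝ) * (i + 1) = (j + 1) * j.choose i := by
  exact_mod_cast (Nat.add_one_mul_choose_eq j i).symm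

/-- The constant terms cancel, which produces the factor `X`. With `(1 - t)/2` substituted, this
will express `(1 - t) P_k^{1,0}` by consecutive Gegenbauer polynomials. -/
theorem hypPoly_sub_succ (c a : ℝ) (ha : 0 < a) (j : ℕ) :
    hypPoly c a j - hypPoly c a (j + 1)
      = C ((2 * j + 1 + c) / a) * (X * hypPoly (c + 1) (a + 1) j) := by
  ext i
  rw [coeff_sub, coeff_C_mul]
  rcases i with _ | i
  · simp [coeff_hypPoly, hypCoeff]
  · rw [coeff_X_mul]
    simp only [coeff_hypPoly, hypCoeff]
    rw [ascPochhammer_eval_succ_left a, ascPochhammer_eval_succ_left ((j : ℝ) + c),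
      ascPochhammer_eval_succ_right (((j + 1 : ℕ) : ℝ) + c)]
    have hp := (ascPochhammer_pos i (a + 1) (by positivity)).ne'
    have h1 := choose_succ_mul_real j i
    have h2 := choose_succ_succ_mul_real j i
    have hi : (i : ℝ) + 1 ≠ 0 := by positivity
    rw [← eq_div_iff hi] at h1 h2
    rw [h1, h2]
    push_cast
    rw [show (j : ℝ) + 1 + c = j + (c + 1) by ring, show (j : ℝ) + c + 1 = j + (c + 1) by ring]
    field_simp
    ring

theorem derivative_hypPoly_succ (c a : ℝ) (ha : 0 < a) (j : ℕ) :
    derivative (hypPoly c a (j + 1))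
      = C (-((j + 1) * (j + 1 + c) / a)) * hypPoly (c + 2) (a + 1) j := by
  ext i
  rw [coeff_derivative, coeff_C_mul]
  simp only [coeff_hypPoly, hypCoeff]
  rw [ascPochhammer_eval_succ_left a, ascPochhammer_eval_succ_left (((j + 1 : ℕ) : ℝ) + c)]
  have hp := (ascPochhammer_pos i (a + 1) (by positivity)).ne'
  have h2 := choose_succ_succ_mul_real j i
  push_cast
  rw [show (j : ℝ) + 1 + c + 1 = j + (c + 2) by ring]
  field_simp
  linear_combination (-1) ^ (i + 1) * (j + 1 + c) * (ascPochhammer ℝ i).eval (j + (c + 2)) * h2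

/-- The choice `c = 2a - 1` is the symmetric case, with equal Jacobi parameters; here the series
obeys the Gegenbauer recurrence. -/
theorem hypPoly_recurrence (a : ℝ) (ha : 0 < a) (j : ℕ) :
    C ((j : ℝ) + 2 * a) * hypPoly (2 * a - 1) a (j + 2)
      = C (2 * (j : ℝ) + 1 + 2 * a) * (hypPoly (2 * a - 1) a (j + 1)
          - C 2 * (X * hypPoly (2 * a - 1) a (j + 1)))
        - C ((j : ℝ) + 1) * hypPoly (2 * a - 1) a j := by
  ext i
  simp only [coeff_sub, coeff_C_mul]
  rcases i with _ | _ | m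
  · simp [coeff_hypPoly, hypCoeff]
    ring
  · rw [coeff_X_mul]
    simp [coeff_hypPoly, hypCoeff]
    field_simp
    ring
  · rw [coeff_X_mul]
    simp only [coeff_hypPoly, hypCoeff]
    -- All Pochhammer values are reduced to the one of order `m` at `j + 1 + 2a`, and all binomials
    -- to `j.choose m`; a rational identity remains.
    have e1 : (ascPochhammer ℝ (m + 1 + 1)).eval (((j + 2 : ℕ) : ℝ) + (2 * a - 1))
        = (ascPochhammer ℝ m).eval (j + 1 + 2 * a) * (j + 1 + 2 * a + m)
            * (j + 1 + 2 * a + m + 1) := by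
      rw [ascPochhammer_eval_succ_right, ascPochhammer_eval_succ_right]
      push_cast
      rw [show (j : ℝ) + 2 + (2 * a - 1) = j + 1 + 2 * a by ring]
      ring
    have e2 : (ascPochhammer ℝ (m + 1 + 1)).eval (((j + 1 : ℕ) : ℝ) + (2 * a - 1))
        = (j + 2 * a) * ((ascPochhammer ℝ m).eval (j + 1 + 2 * a) * (j + 1 + 2 * a + m)) := by
      rw [ascPochhammer_eval_succ_left, ascPochhammer_eval_succ_right]
      push_cast
      rw [show (j : ℝ) + 1 + (2 * a - 1) + 1 = j + 1 + 2 * a by ring]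
      ring
    have e3 : (ascPochhammer ℝ (m + 1)).eval (((j + 1 : ℕ) : ℝ) + (2 * a - 1))
        = (j + 2 * a) * (ascPochhammer ℝ m).eval (j + 1 + 2 * a) := by
      rw [ascPochhammer_eval_succ_left]
      push_cast
      rw [show (j : ℝ) + 1 + (2 * a - 1) + 1 = j + 1 + 2 * a by ring]
      ring
    have e4 : (ascPochhammer ℝ (m + 1 + 1)).eval ((j : ℝ) + (2 * a - 1))
        = (j + 2 * a - 1) * ((j + 2 * a) * (ascPochhammer ℝ m).eval (j + 1 + 2 * a)) := by
      rw [ascPochhammer_eval_succ_left, ascPochhammer_eval_succ_left]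
      rw [show (j : ℝ) + (2 * a - 1) + 1 + 1 = j + 1 + 2 * a by ring]
      ring
    rw [e1, e2, e3, e4, ascPochhammer_eval_succ_right a (m + 1)]
    have hp := (ascPochhammer_pos (m + 1) a ha).ne'
    have hm1 : (m : ℝ) + 1 ≠ 0 := by positivity
    have hm2 : (m : ℝ) + 2 ≠ 0 := by positivity
    have hq : a + ((m + 1 : ℕ) : ℝ) ≠ 0 := by positivity
    have b1 : (j.choose (m + 1) : ℝ) = j.choose m * ((j : ℝ) - m) / (m + 1) := by
      rw [eq_div_iff hm1]; exact choose_succ_mul_real j m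
    have b2 : (j.choose (m + 1 + 1) : ℝ)
        = j.choose m * ((j : ℝ) - m) / (m + 1) * (j - (m + 1)) / (m + 2) := by
      rw [← b1, eq_div_iff hm2]
      have := choose_succ_mul_real j (m + 1)
      push_cast at this
      linear_combination this
    have b3 : ((j + 1).choose (m + 1) : ℝ) = j.choose m * ((j : ℝ) + 1) / (m + 1) := by
      rw [eq_div_iff hm1, choose_succ_succ_mul_real]; ring
    have b4 : ((j + 1).choose (m + 1 + 1) : ℝ)
        = j.choose m * ((j : ℝ) - m) / (m + 1) * (j + 1) / (m + 2) := by
      rw [eq_div_iff hm2]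
      have := choose_succ_succ_mul_real j (m + 1)
      push_cast at this
      rw [b1] at this
      linear_combination this
    have b5 : ((j + 2).choose (m + 1 + 1) : ℝ)
        = j.choose m * ((j : ℝ) + 1) / (m + 1) * (j + 2) / (m + 2) := by
      rw [eq_div_iff hm2]
      have := choose_succ_succ_mul_real (j + 1) (m + 1)
      push_cast at this
      rw [b3] at this
      linear_combination this
    rw [b2, b3, b4, b5]
    push_cast at hq ⊢
    field_simp
    ring

/-! ### Gegenbauer polynomials and their adjacent polynomials -/

theorem gegenbauer_zero : gegenbauer n 0 = 1 := by rw [gegenbauer]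

theorem gegenbauer_one : gegenbauer n 1 = X := by rw [gegenbauer]

theorem gegenbauer_add_two (hn : 3 ≤ n) (i : ℕ) :
    C ((i : ℝ) + n - 1) * gegenbauer n (i + 2)
      = C (2 * (i : ℝ) + n) * (X * gegenbauer n (i + 1)) - C ((i : ℝ) + 1) * gegenbauer n i := by
  have h3 : (3 : ℝ) ≤ n := by exact_mod_cast hn
  have h : (i : ℝ) + 1 + n - 2 ≠ 0 := by
    have := i.cast_nonneg (α := ℝ)
    linarith
  rw [gegenbauer, mul_sub, ← mul_assoc, ← mul_assoc, ← mul_assoc, ← C_mul, ← C_mul,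
    ← mul_assoc (C _) X]
  congr 4
  · field_simp; ring
  · field_simp; ring

theorem gegenbauer_eq_comp (hn : 3 ≤ n) (k : ℕ) :
    gegenbauer n k = (hypPoly (n - 2) (((n : ℝ) - 1) / 2) k).comp (C (1 / 2) * (1 - X)) := by
  have h3 : (3 : ℝ) ≤ n := by exact_mod_cast hn
  induction k using Nat.twoStepInduction with
  | zero => simp [gegenbauer_zero, hypPoly, hypCoeff]
  | one =>
    have c0 : hypCoeff ((n : ℝ) - 2) ((n - 1) / 2) 1 0 = 1 := by simp [hypCoeff]
    have c1 : hypCoeff ((n : ℝ) - 2) ((n - 1) / 2) 1 1 = -2 := by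
      simp only [hypCoeff, ascPochhammer_one, eval_X]
      field_simp [show (n : ℝ) - 1 ≠ 0 by linarith]
      push_cast [Nat.choose_self]
      ring
    have h3 : (C 2 * C (1 / 2) : ℝ[X]) = 1 := by rw [← C_mul]; norm_num
    simp only [gegenbauer_one, hypPoly, Finset.sum_range_succ, Finset.sum_range_zero, add_comp,
      monomial_comp, c0, c1, map_neg, map_one, pow_zero, pow_one, neg_comp, zero_add]
    linear_combination (1 - X) * h3
  | more k h1 h2 =>
    have hr := gegenbauer_add_two hn k
    have hh := congrArg (fun p => p.comp (C (1 / 2) * (1 - X)))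
      (hypPoly_recurrence (((n : ℝ) - 1) / 2) (by linarith) k)
    rw [show 2 * (((n : ℝ) - 1) / 2) - 1 = n - 2 by ring,
      show 2 * (((n : ℝ) - 1) / 2) = n - 1 by ring] at hh
    simp only [mul_comp, sub_comp, C_comp, X_comp, ← h1, ← h2] at hh
    have h0 : (C ((k : ℝ) + (n - 1)) : ℝ[X]) ≠ 0 := by
      rw [Ne, C_eq_zero]
      have := k.cast_nonneg (α := ℝ)
      linarith
    apply mul_left_cancel₀ h0
    have h3 : (C 2 * C (1 / 2) : ℝ[X]) = 1 := by rw [← C_mul]; norm_num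
    rw [hh]
    simp only [map_add, map_sub, map_mul, map_natCast, map_one, map_ofNat] at hr h3 ⊢
    linear_combination hr + (2 * (k : ℝ[X]) + n) * (1 - X) * gegenbauer n (k + 1) * h3

theorem adj_one_zero_eq_comp (k : ℕ) :
    adj n 1 0 k
      = (hypPoly (n - 2 + 1) (((n : ℝ) - 1) / 2 + 1) k).comp (C (1 / 2) * (1 - X)) := by
  rw [adj, jacobi_eq_comp]
  congr 2 <;> push_cast <;> ring

theorem adj_one_one_eq_comp (k : ℕ) :
    adj n 1 1 k
      = (hypPoly (n - 2 + 2) (((n : ℝ) - 1) / 2 + 1) k).comp (C (1 / 2) * (1 - X)) := by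
  rw [adj, jacobi_eq_comp]
  congr 2 <;> push_cast <;> ring

theorem eval_one_hypPoly_comp (c a : ℝ) (k : ℕ) :
    ((hypPoly c a k).comp (C (1 / 2) * (1 - X))).eval 1 = 1 := by
  rw [eval_comp]
  simp [← coeff_zero_eq_eval_zero, coeff_hypPoly, hypCoeff]

theorem gegenbauer_eval_one (hn : 3 ≤ n) (k : ℕ) : (gegenbauer n k).eval 1 = 1 := by
  rw [gegenbauer_eq_comp hn, eval_one_hypPoly_comp]

theorem adj_one_zero_eval_one (k : ℕ) : (adj n 1 0 k).eval 1 = 1 := by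
  rw [adj_one_zero_eq_comp, eval_one_hypPoly_comp]

theorem adj_one_one_eval_one (k : ℕ) : (adj n 1 1 k).eval 1 = 1 := by
  rw [adj_one_one_eq_comp, eval_one_hypPoly_comp]

theorem one_sub_X_mul_adj (hn : 3 ≤ n) (k : ℕ) :
    C (2 * (k : ℝ) + n - 1) * ((1 - X) * adj n 1 0 k)
      = C ((n : ℝ) - 1) * (gegenbauer n k - gegenbauer n (k + 1)) := by
  have h3 : (3 : ℝ) ≤ n := by exact_mod_cast hn
  have hh := congrArg (fun p => p.comp (C (1 / 2) * (1 - X)))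
      (hypPoly_sub_succ ((n : ℝ) - 2) (((n : ℝ) - 1) / 2) (by linarith) k)
  simp only [mul_comp, sub_comp, C_comp, X_comp] at hh
  rw [← gegenbauer_eq_comp hn, ← gegenbauer_eq_comp hn, ← adj_one_zero_eq_comp] at hh
  rw [hh, ← mul_assoc, ← mul_assoc, ← mul_assoc, ← mul_assoc, ← C_mul, ← C_mul]
  congr 3
  field_simp [show (n : ℝ) - 1 ≠ 0 by linarith]
  ring

theorem derivative_gegenbauer_succ (hn : 3 ≤ n) (k : ℕ) :
    C ((n : ℝ) - 1) * derivative (gegenbauer n (k + 1))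
      = C (((k : ℝ) + 1) * (k + n - 1)) * adj n 1 1 k := by
  have h3 : (3 : ℝ) ≤ n := by exact_mod_cast hn
  rw [gegenbauer_eq_comp hn, derivative_comp, derivative_hypPoly_succ _ _ (by linarith), mul_comp,
    ← adj_one_one_eq_comp, C_comp]
  have : derivative (C (1 / 2) * (1 - X) : ℝ[X]) = C (-(1 / 2)) := by
    simp [derivative_mul]
  rw [this, ← mul_assoc (C (-(1 / 2))), ← mul_assoc, ← C_mul, ← C_mul]
  congr 2
  field_simp [show (n : ℝ) - 1 ≠ 0 by linarith]
  ring

/-- The two structure relations are proved jointly: the first at `k + 1` comes from the second at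
`k`, and the second at `k + 1` needs both, together with the differentiated recurrence. -/
theorem one_sub_sq_mul_derivative_gegenbauer (hn : 3 ≤ n) (k : ℕ) :
    (1 - X ^ 2) * derivative (gegenbauer n k)
        = C ((k : ℝ) + n - 2) * (X * gegenbauer n k - gegenbauer n (k + 1)) ∧
      (1 - X ^ 2) * derivative (gegenbauer n (k + 1))
        = C ((k : ℝ) + 1) * (gegenbauer n k - X * gegenbauer n (k + 1)) := by
  have h3 : (3 : ℝ) ≤ n := by exact_mod_cast hn
  induction k with
  | zero =>
    simp [gegenbauer_zero, gegenbauer_one]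
    ring
  | succ k ih =>
    obtain ⟨hW, hU⟩ := ih
    have hr := gegenbauer_add_two hn k
    have hd := congrArg derivative hr
    have h0 : (C ((k : ℝ) + n - 1) : ℝ[X]) ≠ 0 := by
      rw [Ne, C_eq_zero]
      have := k.cast_nonneg (α := ℝ)
      linarith
    simp only [derivative_mul, derivative_C, derivative_sub, derivative_X] at hd
    refine ⟨?_, mul_left_cancel₀ h0 ?_⟩
    · rw [hU]
      simp only [map_add, map_sub, map_mul, map_natCast, map_one, map_ofNat] at hr ⊢
      push_cast
      linear_combination hr
    · simp only [map_add, map_sub, map_mul, map_natCast, map_one, map_ofNat] at hd hr hU hW ⊢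
      push_cast
      linear_combination (1 - X ^ 2) * hd + (2 * (k : ℝ[X]) + n) * X * hU - ((k : ℝ[X]) + 1) * hW
        + ((k : ℝ[X]) + 2) * X * hr

theorem one_add_X_mul_adj_one_one (hn : 3 ≤ n) (k : ℕ) :
    C (2 * ((k : ℝ) + n - 1)) * ((1 + X) * adj n 1 1 k)
      = C ((n : ℝ) - 1) * (gegenbauer n k + gegenbauer n (k + 1))
        + C (2 * (k : ℝ) + n - 1) * ((1 + X) * adj n 1 0 k) := by
  have hX : (1 - X : ℝ[X]) ≠ 0 := sub_ne_zero.2 (X_ne_C 1).symm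
  have hk : (C ((k : ℝ) + 1) : ℝ[X]) ≠ 0 := by
    rw [Ne, C_eq_zero]
    positivity
  have h1 := (one_sub_sq_mul_derivative_gegenbauer hn k).2
  have h2 := derivative_gegenbauer_succ hn k
  have h4 := one_sub_X_mul_adj hn k
  apply mul_left_cancel₀ hX
  apply mul_left_cancel₀ hk
  simp only [map_add, map_sub, map_mul, map_natCast, map_one, map_ofNat] at h1 h2 h4 ⊢
  linear_combination 2 * ((n : ℝ[X]) - 1) * h1 - 2 * (1 - X ^ 2) * h2 - (k + 1) * (1 + X) * h4

/-- Together with `one_add_X_mul_adj_one_one` at `k + 1`, this writes `(1 + t) P_k^{1,1}` and `(1 +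
t) P_{k+1}^{1,1}` in the same two quantities, the ones that occur in the equation `L_{2k+2}(n, s) =
M`. -/
theorem one_add_X_mul_adj_one_one' (hn : 3 ≤ n) (k : ℕ) :
    C (2 * ((k : ℝ) + 1)) * ((1 + X) * adj n 1 1 k)
      = C (2 * (k : ℝ) + n + 1) * ((1 + X) * adj n 1 0 (k + 1))
        - C ((n : ℝ) - 1) * (gegenbauer n (k + 1) + gegenbauer n (k + 2)) := by
  have h3 : (3 : ℝ) ≤ n := by exact_mod_cast hn
  have hX : (1 - X : ℝ[X]) ≠ 0 := sub_ne_zero.2 (X_ne_C 1).symm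
  have hk : (C ((k : ℝ) + n - 1) : ℝ[X]) ≠ 0 := by
    rw [Ne, C_eq_zero]
    have := k.cast_nonneg (α := ℝ)
    linarith
  have h1 := (one_sub_sq_mul_derivative_gegenbauer hn (k + 1)).1
  have h2 := derivative_gegenbauer_succ hn k
  have h4 := one_sub_X_mul_adj hn (k + 1)
  apply mul_left_cancel₀ hX
  apply mul_left_cancel₀ hk
  simp only [map_add, map_sub, map_mul, map_natCast, map_one, map_ofNat, Nat.cast_add,
    Nat.cast_one] at h1 h2 h4 ⊢
  linear_combination 2 * ((n : ℝ[X]) - 1) * h1 - 2 * (1 - X ^ 2) * h2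
    - (k + n - 1) * (1 + X) * h4

theorem one_sub_sq_mul_adj_one_one (hn : 3 ≤ n) (k : ℕ) :
    C (2 * (k : ℝ) + n) * ((1 - X ^ 2) * adj n 1 1 k)
      = C ((n : ℝ) - 1) * (gegenbauer n k - gegenbauer n (k + 2)) := by
  have h3 : (3 : ℝ) ≤ n := by exact_mod_cast hn
  have hk : (C (((k : ℝ) + 1) * (k + n - 1)) : ℝ[X]) ≠ 0 := by
    rw [Ne, C_eq_zero]
    have := k.cast_nonneg (α := ℝ)
    exact mul_ne_zero (by positivity) (by linarith)
  have h1 := (one_sub_sq_mul_derivative_gegenbauer hn k).2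
  have h2 := derivative_gegenbauer_succ hn k
  have hr := gegenbauer_add_two hn k
  apply mul_left_cancel₀ hk
  simp only [map_add, map_sub, map_mul, map_natCast, map_one, map_ofNat] at h1 h2 hr ⊢
  linear_combination ((n : ℝ[X]) - 1) * (2 * k + n) * h1 - (2 * k + n) * (1 - X ^ 2) * h2
    + ((n : ℝ[X]) - 1) * (k + 1) * hr

theorem natDegree_gegenbauer (hn : 3 ≤ n) (k : ℕ) : (gegenbauer n k).natDegree = k := by
  have h3 : (3 : ℝ) ≤ n := by exact_mod_cast hn
  induction k using Nat.twoStepInduction with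
  | zero => simp [gegenbauer_zero]
  | one => simp [gegenbauer_one]
  | more k h1 h2 =>
    have hk0 := k.cast_nonneg (α := ℝ)
    have hr := gegenbauer_add_two hn k
    have hg : gegenbauer n (k + 1) ≠ 0 := by
      intro h
      simp [h] at h2
    rw [← natDegree_C_mul (p := gegenbauer n (k + 2)) (a := (k : ℝ) + n - 1) (by linarith), hr]
    have ha : (C (2 * (k : ℝ) + n) * (X * gegenbauer n (k + 1))).natDegree = k + 2 := by
      rw [natDegree_C_mul (by linarith), natDegree_X_mul hg, h2]
    rw [natDegree_sub_eq_left_of_natDegree_lt, ha]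
    rw [ha]
    exact (natDegree_C_mul_le _ _).trans_lt (by lia)

theorem natDegree_adj_one_zero (hn : 3 ≤ n) (k : ℕ) : (adj n 1 0 k).natDegree = k := by
  have h3 : (3 : ℝ) ≤ n := by exact_mod_cast hn
  have hk0 := k.cast_nonneg (α := ℝ)
  have h := congrArg natDegree (one_sub_X_mul_adj hn k)
  have hX : (1 - X : ℝ[X]).natDegree = 1 := by
    rw [natDegree_sub, ← C_1]
    exact natDegree_X_sub_C 1
  have h0 : adj n 1 0 k ≠ 0 := by
    intro h
    have := adj_one_zero_eval_one (n := n) k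
    simp [h] at this
  rw [natDegree_C_mul (by linarith), natDegree_C_mul (by linarith),
    natDegree_mul (by intro h; simp [h] at hX) h0, hX,
    natDegree_sub_eq_right_of_natDegree_lt (by simp [natDegree_gegenbauer hn]),
    natDegree_gegenbauer hn] at h
  lia

theorem natDegree_adj_one_one (hn : 3 ≤ n) (k : ℕ) : (adj n 1 1 k).natDegree = k := by
  have h3 : (3 : ℝ) ≤ n := by exact_mod_cast hn
  have hk0 := k.cast_nonneg (α := ℝ)
  have h := congrArg natDegree (derivative_gegenbauer_succ hn k)
  rw [natDegree_C_mul (by linarith), natDegree_C_mul (mul_ne_zero (by positivity) (by linarith)),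
    natDegree_derivative, natDegree_gegenbauer hn] at h
  simpa using h.symm

theorem gegenbauer_comp_neg_X (hn : 3 ≤ n) (k : ℕ) :
    (gegenbauer n k).comp (-X) = (-1) ^ k * gegenbauer n k := by
  have h3 : (3 : ℝ) ≤ n := by exact_mod_cast hn
  induction k using Nat.twoStepInduction with
  | zero => simp [gegenbauer_zero]
  | one => simp [gegenbauer_one]
  | more k h1 h2 =>
    have hr := gegenbauer_add_two hn k
    have hc := congrArg (fun p => p.comp (-X)) hr
    simp only [mul_comp, sub_comp, C_comp, X_comp, h1, h2] at hc
    have h0 : (C ((k : ℝ) + n - 1) : ℝ[X]) ≠ 0 := by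
      rw [Ne, C_eq_zero]
      have := k.cast_nonneg (α := ℝ)
      linarith
    apply mul_left_cancel₀ h0
    rw [hc]
    linear_combination -(-1) ^ k * hr

/-- Differentiating the parity relation of `P_{k+1}^{(n)}` gives this, because `P_k^{1,1}` is
proportional to that derivative. -/
theorem adj_one_one_eval_neg_one (hn : 3 ≤ n) (k : ℕ) :
    (adj n 1 1 k).eval (-1) = (-1) ^ k := by
  have h3 : (3 : ℝ) ≤ n := by exact_mod_cast hn
  have hk0 := k.cast_nonneg (α := ℝ)
  have h := congrArg (fun p => (derivative p).eval 1) (gegenbauer_comp_neg_X hn (k + 1))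
  have hd := derivative_gegenbauer_succ hn k
  have h1 := congrArg (eval 1) hd
  have h2 := congrArg (eval (-1)) hd
  have hp : derivative ((-1) ^ (k + 1) * gegenbauer n (k + 1))
      = (-1) ^ (k + 1) * derivative (gegenbauer n (k + 1)) := by
    rw [show ((-1) ^ (k + 1) : ℝ[X]) = C ((-1) ^ (k + 1)) by simp, derivative_C_mul]
  simp only [derivative_comp, hp] at h
  simp [eval_comp] at h
  simp only [eval_mul, eval_C, adj_one_one_eval_one] at h1 h2
  have hc : ((k : ℝ) + 1) * (k + n - 1) ≠ 0 := mul_ne_zero (by positivity) (by linarith)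
  apply mul_left_cancel₀ hc
  rw [← h2]
  linear_combination -((n : ℝ) - 1) * h - (-1) ^ (k + 1) * h1

/-! ### The mean `f₀` and orthogonality -/

theorem continuous_one_sub_sq_rpow {r : ℝ} (hr : 0 ≤ r) :
    Continuous fun t : ℝ => (1 - t ^ 2) ^ r :=
  (by fun_prop : Continuous fun t : ℝ => 1 - t ^ 2).rpow_const fun _ => Or.inr hr

theorem gegenbauerExponent_nonneg (hn : 3 ≤ n) : 0 ≤ ((n : ℝ) - 3) / 2 := by
  have h3 : (3 : ℝ) ≤ n := by exact_mod_cast hn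
  linarith

theorem continuous_gegenbauerIntegrand (hn : 3 ≤ n) (f : ℝ[X]) :
    Continuous fun t : ℝ => f.eval t * (1 - t ^ 2) ^ (((n : ℝ) - 3) / 2) :=
  f.continuous.mul (continuous_one_sub_sq_rpow (gegenbauerExponent_nonneg hn))

/-- The functional `f ↦ f₀` as a linear map. -/
def gegenbauerMean (hn : 3 ≤ n) : ℝ[X] →ₗ[ℝ] ℝ where
  toFun := gegenbauerCoeffZero n
  map_add' f g := by
    simp only [gegenbauerCoeffZero, eval_add, add_mul]
    rw [intervalIntegral.integral_add
      ((continuous_gegenbauerIntegrand hn f).intervalIntegrable _ _)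
      ((continuous_gegenbauerIntegrand hn g).intervalIntegrable _ _), add_div]
  map_smul' c f := by
    simp only [gegenbauerCoeffZero, eval_smul, smul_eq_mul, mul_assoc, RingHom.id_apply]
    rw [intervalIntegral.integral_const_mul, mul_div_assoc]

theorem gegenbauerMean_apply (hn : 3 ≤ n) (f : ℝ[X]) :
    gegenbauerMean hn f = gegenbauerCoeffZero n f := rfl

theorem gegenbauerMean_C_mul (hn : 3 ≤ n) (c : ℝ) (f : ℝ[X]) :
    gegenbauerMean hn (C c * f) = c * gegenbauerMean hn f := by
  rw [← smul_eq_C_mul, map_smul, smul_eq_mul]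

theorem integral_gegenbauerIntegrand_pos (hn : 3 ≤ n) {p : ℝ[X]} (hp : p ≠ 0)
    (h : ∀ t ∈ Set.Ioo (-1 : ℝ) 1, 0 ≤ p.eval t) :
    0 < ∫ t in (-1 : ℝ)..1, p.eval t * (1 - t ^ 2) ^ (((n : ℝ) - 3) / 2) := by
  have hcl : ∀ t ∈ Set.Icc (-1 : ℝ) 1, 0 ≤ p.eval t := by
    intro t ht
    rw [← closure_Ioo (by norm_num)] at ht
    exact closure_minimal (t := {t | 0 ≤ p.eval t}) h
      (isClosed_le continuous_const p.continuous) ht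
  obtain ⟨c, hc, hc0⟩ : ∃ c ∈ Set.Ioo (-1 : ℝ) 1, p.eval c ≠ 0 := by
    by_contra! hcon
    refine hp (p.eq_zero_of_infinite_isRoot ?_)
    exact (Set.Ioo_infinite (by norm_num : (-1 : ℝ) < 1)).mono fun t ht => hcon t ht
  refine intervalIntegral.integral_pos (by norm_num)
    (continuous_gegenbauerIntegrand hn p).continuousOn (fun t ht => ?_)
    ⟨c, Set.Ioo_subset_Icc_self hc, ?_⟩
  · exact mul_nonneg (hcl t (Set.Ioc_subset_Icc_self ht))
      (Real.rpow_nonneg (by nlinarith [ht.1, ht.2]) _)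
  · exact mul_pos ((h c hc).lt_of_ne' hc0) (Real.rpow_pos_of_pos (by nlinarith [hc.1, hc.2]) _)

theorem integral_gegenbauerWeight_pos (hn : 3 ≤ n) :
    0 < ∫ t in (-1 : ℝ)..1, (1 - t ^ 2) ^ (((n : ℝ) - 3) / 2) := by
  simpa using integral_gegenbauerIntegrand_pos hn (p := 1) one_ne_zero (by simp)

theorem gegenbauerMean_pos (hn : 3 ≤ n) {p : ℝ[X]} (hp : p ≠ 0)
    (h : ∀ t ∈ Set.Ioo (-1 : ℝ) 1, 0 ≤ p.eval t) : 0 < gegenbauerMean hn p :=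
  div_pos (integral_gegenbauerIntegrand_pos hn hp h) (integral_gegenbauerWeight_pos hn)

theorem gegenbauerMean_one (hn : 3 ≤ n) : gegenbauerMean hn 1 = 1 := by
  rw [gegenbauerMean_apply, gegenbauerCoeffZero]
  simp only [eval_one, one_mul]
  exact div_self (integral_gegenbauerWeight_pos hn).ne'

/-- Integration by parts against the weight `(1 - t²)^{(n-3)/2}`. -/
theorem gegenbauerMean_mul_derivative (hn : 3 ≤ n) (q : ℝ[X]) :
    gegenbauerMean hn ((1 - X ^ 2) * derivative q)
      = ((n : ℝ) - 1) * gegenbauerMean hn (X * q) := by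
  rw [← gegenbauerMean_C_mul, ← sub_eq_zero, ← map_sub, gegenbauerMean_apply, gegenbauerCoeffZero,
    div_eq_zero_iff]
  left
  set r := ((n : ℝ) - 3) / 2 with hr
  have hr0 : 0 ≤ r := gegenbauerExponent_nonneg hn
  -- The integrand is the derivative of `q(t) (1 - t²)^(r + 1)`, where `2 (r + 1) = n - 1`; this
  -- primitive vanishes at `±1`.
  have hd : ∀ t ∈ Set.uIcc (-1 : ℝ) 1, HasDerivAt (fun t : ℝ => q.eval t * (1 - t ^ 2) ^ (r + 1))
      (((1 - X ^ 2) * derivative q - C ((n : ℝ) - 1) * (X * q)).eval t * (1 - t ^ 2) ^ r) t := by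
    intro t ht
    rw [Set.uIcc_of_le (by norm_num)] at ht
    have h1 : HasDerivAt (fun t : ℝ => 1 - t ^ 2) (-(2 * t)) t := by
      simpa using (hasDerivAt_pow 2 t).const_sub 1
    have h2 := (q.hasDerivAt t).mul (h1.rpow_const (p := r + 1) (Or.inr (by linarith)))
    refine h2.congr_deriv ?_
    have h3 : (1 - t ^ 2) ^ (r + 1) = (1 - t ^ 2) ^ r * (1 - t ^ 2) := by
      rw [Real.rpow_add_one' (by nlinarith [ht.1, ht.2]) (by linarith)]
    rw [h3]
    simp only [add_sub_cancel_right, eval_sub, eval_mul, eval_one, eval_pow, eval_X, eval_C, hr]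
    ring
  rw [intervalIntegral.integral_eq_sub_of_hasDerivAt hd
    ((continuous_gegenbauerIntegrand hn _).intervalIntegrable _ _)]
  have : r + 1 ≠ 0 := by linarith
  simp [Real.zero_rpow this]

theorem gegenbauerMean_X_pow_add_two (hn : 3 ≤ n) (j : ℕ) :
    ((n : ℝ) + j) * gegenbauerMean hn (X ^ (j + 2)) = (j + 1) * gegenbauerMean hn (X ^ j) := by
  have h := gegenbauerMean_mul_derivative hn (X ^ (j + 1))
  have e1 : (1 - X ^ 2) * derivative (X ^ (j + 1) : ℝ[X])
      = C ((j : ℝ) + 1) * (X ^ j - X ^ (j + 2)) := by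
    rw [derivative_X_pow]
    simp
    ring
  have e2 : (X * X ^ (j + 1) : ℝ[X]) = X ^ (j + 2) := by ring
  rw [e1, e2, gegenbauerMean_C_mul, map_sub] at h
  linear_combination -h

theorem gegenbauerMean_X (hn : 3 ≤ n) : gegenbauerMean hn X = 0 := by
  have h3 : (3 : ℝ) ≤ n := by exact_mod_cast hn
  have h := gegenbauerMean_mul_derivative hn 1
  simp only [derivative_one, mul_zero, map_zero, mul_one] at h
  exact (mul_eq_zero.1 h.symm).resolve_left (by linarith)

theorem gegenbauerMean_gegenbauer_succ (hn : 3 ≤ n) (k : ℕ) :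
    gegenbauerMean hn (gegenbauer n (k + 1)) = 0 := by
  have h3 : (3 : ℝ) ≤ n := by exact_mod_cast hn
  -- Eliminating the mean of `X P_{k+1}` from the two structure relations links the means of
  -- `P_{k+2}` and `P_k`. The factor `k` on the right kills the mean of `P_2`.
  have key : ∀ k : ℕ, ((k : ℝ) + n - 1) * (k + n) * gegenbauerMean hn (gegenbauer n (k + 2))
      = k * (k + 1) * gegenbauerMean hn (gegenbauer n k) := by
    intro k
    have hI := gegenbauerMean_mul_derivative hn (gegenbauer n (k + 1))
    have hU := hI
    rw [(one_sub_sq_mul_derivative_gegenbauer hn (k + 1)).1, gegenbauerMean_C_mul, map_sub] at hI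
    rw [(one_sub_sq_mul_derivative_gegenbauer hn k).2, gegenbauerMean_C_mul, map_sub] at hU
    push_cast at hI
    linear_combination -((k : ℝ) + n) * hI - k * hU
  induction k using Nat.twoStepInduction with
  | zero => rw [gegenbauer_one, gegenbauerMean_X]
  | one =>
    have := key 0
    simp only [Nat.cast_zero, zero_add, zero_mul] at this
    exact (mul_eq_zero.1 this).resolve_left (mul_ne_zero (by linarith) (by linarith))
  | more k h1 h2 =>
    have := key (k + 1)
    rw [h1, mul_zero] at this
    have hk := k.cast_nonneg (α := ℝ)
    refine (mul_eq_zero.1 this).resolve_left (mul_ne_zero ?_ ?_) <;> push_cast <;> linarith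

/-- The three-term recurrence trades one factor `X` for a shift of the index by at most one, so the
claim descends to `i = 0`. -/
theorem gegenbauerMean_gegenbauer_mul_X_pow (hn : 3 ≤ n) (i k : ℕ) (hik : i < k) :
    gegenbauerMean hn (gegenbauer n k * X ^ i) = 0 := by
  have h3 : (3 : ℝ) ≤ n := by exact_mod_cast hn
  induction i generalizing k with
  | zero =>
    obtain ⟨k, rfl⟩ := Nat.exists_eq_succ_of_ne_zero hik.ne'
    simpa using gegenbauerMean_gegenbauer_succ hn k
  | succ i ih =>
    obtain ⟨k, rfl⟩ : ∃ m, k = m + 1 := ⟨k - 1, by lia⟩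
    have hk := k.cast_nonneg (α := ℝ)
    have e : C (2 * (k : ℝ) + n) * (gegenbauer n (k + 1) * X ^ (i + 1))
        = C ((k : ℝ) + n - 1) * (gegenbauer n (k + 2) * X ^ i)
          + C ((k : ℝ) + 1) * (gegenbauer n k * X ^ i) := by
      linear_combination -X ^ i * gegenbauer_add_two hn k
    have h := congrArg (gegenbauerMean hn) e
    rw [map_add (gegenbauerMean hn), gegenbauerMean_C_mul, gegenbauerMean_C_mul,
      gegenbauerMean_C_mul, ih (k + 2) (by lia), ih k (by lia), mul_zero, mul_zero, add_zero] at h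
    exact (mul_eq_zero.1 h).resolve_left (by linarith)

theorem gegenbauerMean_gegenbauer_mul (hn : 3 ≤ n) {k : ℕ} {q : ℝ[X]} (hq : q.degree < k) :
    gegenbauerMean hn (gegenbauer n k * q) = 0 := by
  rw [q.as_sum_support_C_mul_X_pow, Finset.mul_sum, map_sum]
  refine Finset.sum_eq_zero fun i hi => ?_
  have hik : i < k := by exact_mod_cast (le_degree_of_mem_supp i hi).trans_lt hq
  rw [mul_left_comm, gegenbauerMean_C_mul, gegenbauerMean_gegenbauer_mul_X_pow hn i k hik, mul_zero]

theorem gegenbauerMean_adj_one_zero_mul (hn : 3 ≤ n) {k : ℕ} {q : ℝ[X]} (hq : q.degree < k) :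
    gegenbauerMean hn ((1 - X) * adj n 1 0 k * q) = 0 := by
  have h3 : (3 : ℝ) ≤ n := by exact_mod_cast hn
  have hk := k.cast_nonneg (α := ℝ)
  have e : C (2 * (k : ℝ) + n - 1) * ((1 - X) * adj n 1 0 k * q)
      = C ((n : ℝ) - 1) * (gegenbauer n k * q - gegenbauer n (k + 1) * q) := by
    linear_combination q * one_sub_X_mul_adj hn k
  have h := congrArg (gegenbauerMean hn) e
  rw [gegenbauerMean_C_mul, gegenbauerMean_C_mul, map_sub, gegenbauerMean_gegenbauer_mul hn hq,
    gegenbauerMean_gegenbauer_mul hn (hq.trans (by exact_mod_cast (by lia : k < k + 1))),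
    sub_zero, mul_zero] at h
  exact (mul_eq_zero.1 h).resolve_left (by linarith)

theorem gegenbauerMean_adj_one_one_mul (hn : 3 ≤ n) {k : ℕ} {q : ℝ[X]} (hq : q.degree < k) :
    gegenbauerMean hn ((1 - X ^ 2) * adj n 1 1 k * q) = 0 := by
  have h3 : (3 : ℝ) ≤ n := by exact_mod_cast hn
  have hk := k.cast_nonneg (α := ℝ)
  have e : C (2 * (k : ℝ) + n) * ((1 - X ^ 2) * adj n 1 1 k * q)
      = C ((n : ℝ) - 1) * (gegenbauer n k * q - gegenbauer n (k + 2) * q) := by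
    linear_combination q * one_sub_sq_mul_adj_one_one hn k
  have h := congrArg (gegenbauerMean hn) e
  rw [gegenbauerMean_C_mul, gegenbauerMean_C_mul, map_sub, gegenbauerMean_gegenbauer_mul hn hq,
    gegenbauerMean_gegenbauer_mul hn (hq.trans (by exact_mod_cast (by lia : k < k + 2))),
    sub_zero, mul_zero] at h
  exact (mul_eq_zero.1 h).resolve_left (by linarith)

/-! ### Delsarte-Goethals-Seidel numbers as reciprocals of means -/

theorem choose_recurrence (hn : 3 ≤ n) (k : ℕ) :
    ((k + 1 + n - 2).choose (k + 1) : ℝ) * (k + 1)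
      = ((k + n - 2).choose k : ℝ) * (k + n - 1) := by
  have h := choose_succ_succ_mul_real (k + n - 2) k
  rw [show k + n - 2 + 1 = k + 1 + n - 2 by lia] at h
  rw [h, Nat.cast_sub (by lia)]
  push_cast
  ring

theorem cast_dgs_even (hn : 3 ≤ n) (k : ℕ) :
    (dgs n (2 * k) : ℝ) * (n - 1) = (2 * k + n - 1) * (k + n - 2).choose k := by
  have e : (2 * k) / 2 = k := by lia
  have h1 : (n + k - 1).choose (n - 1) = (k + n - 2 + 1).choose k := by
    rw [← Nat.choose_symm_of_eq_add (by lia : n + k - 1 = k + (n - 1))]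
    congr 1; lia
  have h1' := Nat.choose_succ_right_eq (k + n - 2 + 1) k
  have h2 : (n + k - 2).choose (n - 1) * (n - 1) = (k + n - 2).choose k * k := by
    have := Nat.choose_succ_right_eq (k + n - 2) (n - 2)
    rw [show n - 2 + 1 = n - 1 by lia, show k + n - 2 - (n - 2) = k by lia,
      Nat.choose_symm_of_eq_add (by lia : k + n - 2 = (n - 2) + k)] at this
    rw [← this, add_comm n k]
  have h3 := Nat.add_one_mul_choose_eq (k + n - 2) k
  have h4 : (k + n - 2 + 1).choose k * (n - 1) = (k + n - 2).choose k * (k + n - 1) := by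
    rw [show k + n - 2 + 1 - k = n - 1 by lia] at h1'
    rw [← h1', ← h3, show k + n - 2 + 1 = k + n - 1 by lia, mul_comm]
  rw [dgs, if_pos (even_two_mul k), e, h1]
  have h2r : ((n + k - 2).choose (n - 1) : ℝ) * (n - 1) = (k + n - 2).choose k * k := by
    have := congrArg (Nat.cast (R := ℝ)) h2
    push_cast [Nat.cast_sub (by lia : 1 ≤ n)] at this
    exact this
  have h4r : ((k + n - 2 + 1).choose k : ℝ) * (n - 1) = (k + n - 2).choose k * (k + n - 1) := by
    have := congrArg (Nat.cast (R := ℝ)) h4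
    push_cast [Nat.cast_sub (by lia : 1 ≤ n), Nat.cast_sub (by lia : 1 ≤ k + n)] at this
    exact this
  push_cast
  linear_combination h2r + h4r

theorem cast_dgs_odd (hn : 3 ≤ n) (k : ℕ) :
    (dgs n (2 * k + 1) : ℝ) * (n - 1) = 2 * (k + 1) * (k + 1 + n - 2).choose (k + 1) := by
  have h := Nat.choose_succ_right_eq (k + 1 + n - 2) k
  rw [show k + 1 + n - 2 - k = n - 1 by lia] at h
  have hs : (n + (2 * k + 1 + 1) / 2 - 2).choose (n - 1) = (k + 1 + n - 2).choose k := by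
    rw [Nat.choose_symm_of_eq_add (by lia : k + 1 + n - 2 = k + (n - 1))]
    congr 1; lia
  rw [dgs, if_neg (by simp), hs]
  have := congrArg (Nat.cast (R := ℝ)) h
  push_cast [Nat.cast_sub (by lia : 1 ≤ n)] at this ⊢
  linear_combination -2 * this

/-- A telescoped Christoffel-Darboux formula: the coefficient on the right is the dimension of the
harmonic polynomials of degree `k + 1`, so `D(n, 2k) P_k^{1,0}` is the sum of the `P_i` weighted by
these dimensions. -/
theorem dgs_mul_adj_one_zero_succ_sub (hn : 3 ≤ n) (k : ℕ) :
    C (dgs n (2 * (k + 1)) : ℝ) * adj n 1 0 (k + 1) - C (dgs n (2 * k) : ℝ) * adj n 1 0 k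
      = C (((k + 1 + n - 2).choose (k + 1) : ℝ) + ((k + n - 2).choose k : ℝ))
          * gegenbauer n (k + 1) := by
  have h3 : (3 : ℝ) ≤ n := by exact_mod_cast hn
  have hX : (1 - X : ℝ[X]) ≠ 0 := sub_ne_zero.2 (X_ne_C 1).symm
  have hC : (C ((n : ℝ) - 1) : ℝ[X]) ≠ 0 := by
    rw [Ne, C_eq_zero]
    linarith
  have hk1 : (C ((k : ℝ) + 1) : ℝ[X]) ≠ 0 := by
    rw [Ne, C_eq_zero]
    positivity
  have h1 := one_sub_X_mul_adj hn (k + 1)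
  have h2 := one_sub_X_mul_adj hn k
  have hr := gegenbauer_add_two hn k
  have e1 := congrArg C (cast_dgs_even hn (k + 1))
  have e2 := congrArg C (cast_dgs_even hn k)
  have e3 := congrArg C (choose_recurrence hn k)
  apply mul_left_cancel₀ hX
  apply mul_left_cancel₀ hC
  apply mul_left_cancel₀ hk1
  simp only [map_add, map_sub, map_mul, map_natCast, map_one, map_ofNat, Nat.cast_add,
    Nat.cast_one] at h1 h2 hr e1 e2 e3 ⊢
  set c1 : ℝ[X] := ((k + 1 + n - 2).choose (k + 1) : ℝ[X])
  set c0 : ℝ[X] := ((k + n - 2).choose k : ℝ[X])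
  linear_combination (k + 1) * (1 - X) * adj n 1 0 (k + 1) * e1
    - (k + 1) * (1 - X) * adj n 1 0 k * e2 + (k + 1) * c1 * h1 - (k + 1) * c0 * h2
    + ((n : ℝ[X]) - 1) * (gegenbauer n (k + 1) - gegenbauer n (k + 2)) * e3
    - ((n : ℝ[X]) - 1) * c0 * hr - ((n : ℝ[X]) - 1) * (1 - X) * gegenbauer n (k + 1) * e3

/-- By the telescoping relation, `D(n, 2k) P_k^{1,0}` changes with `k` only by a multiple of
`P_{k+1}`, whose mean is zero. -/
theorem gegenbauerMean_adj_one_zero (hn : 3 ≤ n) (k : ℕ) :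
    dgs n (2 * k) * gegenbauerMean hn (adj n 1 0 k) = 1 := by
  have h3 : (3 : ℝ) ≤ n := by exact_mod_cast hn
  induction k with
  | zero =>
    have : adj n 1 0 0 = 1 := by
      have h0 := eq_C_of_natDegree_eq_zero (natDegree_adj_one_zero hn 0)
      have h1 := adj_one_zero_eval_one (n := n) 0
      rw [h0, eval_C] at h1
      rw [h0, h1, C_1]
    rw [this, gegenbauerMean_one]
    have := cast_dgs_even hn 0
    simp only [Nat.cast_zero, mul_zero, zero_add, Nat.choose_zero_right] at this
    rw [mul_one]
    apply mul_right_cancel₀ (by linarith : (n : ℝ) - 1 ≠ 0)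
    simpa using this
  | succ k ih =>
    rw [← ih, ← gegenbauerMean_C_mul, ← gegenbauerMean_C_mul, ← sub_eq_zero, ← map_sub,
      dgs_mul_adj_one_zero_succ_sub hn, gegenbauerMean_C_mul, gegenbauerMean_gegenbauer_succ,
      mul_zero]

theorem gegenbauerMean_one_add_X_mul_adj_one_zero (hn : 3 ≤ n) {k : ℕ} (hk : 1 ≤ k) :
    gegenbauerMean hn ((1 + X) * adj n 1 0 k) = 2 * gegenbauerMean hn (adj n 1 0 k) := by
  have h := gegenbauerMean_adj_one_zero_mul hn (k := k) (q := 1)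
    (by rw [degree_one]; exact_mod_cast hk)
  have e : (1 + X) * adj n 1 0 k = C 2 * adj n 1 0 k - (1 - X) * adj n 1 0 k * 1 := by
    simp only [map_ofNat]
    ring
  rw [e, map_sub, h, gegenbauerMean_C_mul, sub_zero]

theorem gegenbauerMean_one_add_X_mul_adj_one_one (hn : 3 ≤ n) (k : ℕ) :
    dgs n (2 * k + 1) * gegenbauerMean hn ((1 + X) * adj n 1 1 k) = 2 := by
  have h3 : (3 : ℝ) ≤ n := by exact_mod_cast hn
  have h := congrArg (gegenbauerMean hn) (one_add_X_mul_adj_one_one' hn k)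
  rw [map_sub, gegenbauerMean_C_mul, gegenbauerMean_C_mul, gegenbauerMean_C_mul,
    gegenbauerMean_one_add_X_mul_adj_one_zero hn (by lia), map_add,
    gegenbauerMean_gegenbauer_succ, gegenbauerMean_gegenbauer_succ] at h
  have h1 := gegenbauerMean_adj_one_zero hn (k + 1)
  have e1 := cast_dgs_even hn (k + 1)
  have e2 := cast_dgs_odd hn k
  apply mul_left_cancel₀ (by linarith : (n : ℝ) - 1 ≠ 0)
  push_cast at e1
  linear_combination gegenbauerMean hn ((1 + X) * adj n 1 1 k) * e2
    + ((k + 1 + n - 2).choose (k + 1) : ℝ) * h + 2 * ((n : ℝ) - 1) * h1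
    - 2 * gegenbauerMean hn (adj n 1 0 (k + 1)) * e1

/-! ### Averages of zonal polynomials over the sphere -/

theorem integrableOn_pow_mul_exp_neg_sq (m : ℕ) :
    IntegrableOn (fun r : ℝ => r ^ m * Real.exp (-r ^ 2)) (Set.Ioi 0) := by
  have := integrableOn_rpow_mul_exp_neg_mul_sq (b := 1) one_pos (s := m)
    (by have := m.cast_nonneg (α := ℝ); linarith)
  simpa [Real.rpow_natCast] using this

theorem integral_pow_mul_exp_neg_sq (m : ℕ) :
    ∫ r in Set.Ioi (0 : ℝ), r ^ m * Real.exp (-r ^ 2) = 1 / 2 * Real.Gamma (((m : ℝ) + 1) / 2) := by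
  have := integral_rpow_mul_exp_neg_rpow (p := 2) two_pos (q := m)
    (by have := m.cast_nonneg (α := ℝ); linarith)
  rw [← this]
  simp only [Real.rpow_natCast, Real.rpow_two]

theorem integrable_inner_pow_mul_exp (hn : 3 ≤ n) (y : Sph n) (j : ℕ) :
    Integrable fun x : EuclideanSpace ℝ (Fin n) => inner ℝ x y.1 ^ j * Real.exp (-‖x‖ ^ 2) := by
  have : Nonempty (Fin n) := ⟨⟨0, by lia⟩⟩
  have : Nontrivial (EuclideanSpace ℝ (Fin n)) := inferInstance
  have h : Integrable fun x : EuclideanSpace ℝ (Fin n) => ‖x‖ ^ j * Real.exp (-‖x‖ ^ 2) := by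
    rw [integrable_fun_norm_addHaar volume (f := fun r => r ^ j * Real.exp (-r ^ 2))]
    refine (integrableOn_pow_mul_exp_neg_sq (n - 1 + j)).congr_fun (fun r _ => ?_)
      measurableSet_Ioi
    simp [pow_add, mul_assoc]
  refine h.mono (Continuous.aestronglyMeasurable (by fun_prop)) (Filter.Eventually.of_forall ?_)
  intro x
  rw [norm_mul, norm_mul, norm_pow, norm_pow, norm_norm]
  gcongr
  have hy : ‖y.1‖ = 1 := by simp
  simpa [hy] using norm_inner_le_norm (𝕜 := ℝ) x y.1

/-- Polar coordinates: homogeneity splits off `r ^ j`, and the radial Gaussian integral is a Gamma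
value. -/
theorem integral_inner_pow_mul_exp_eq (hn : 3 ≤ n) (y : Sph n) (j : ℕ) :
    ∫ x : EuclideanSpace ℝ (Fin n), inner ℝ x y.1 ^ j * Real.exp (-‖x‖ ^ 2)
      = (∫ x : Sph n, inner ℝ x.1 y.1 ^ j
            ∂((volume : Measure (EuclideanSpace ℝ (Fin n))).toSphere))
          * (1 / 2 * Real.Gamma (((n : ℝ) + j) / 2)) := by
  have : Nonempty (Fin n) := ⟨⟨0, by lia⟩⟩
  set E := EuclideanSpace ℝ (Fin n)
  have hr : ∫ r : Set.Ioi (0 : ℝ), r.1 ^ j * Real.exp (-r.1 ^ 2) ∂(Measure.volumeIoiPow (n - 1))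
      = 1 / 2 * Real.Gamma (((n : ℝ) + j) / 2) := by
    simp only [Measure.volumeIoiPow, ENNReal.ofReal]
    rw [integral_withDensity_eq_integral_smul,
      integral_subtype_comap measurableSet_Ioi
        fun a : ℝ => Real.toNNReal (a ^ (n - 1)) • (a ^ j * Real.exp (-a ^ 2))]
    · rw [show ((n : ℝ) + j) / 2 = (((n - 1 + j : ℕ) : ℝ) + 1) / 2 by
        rw [Nat.cast_add, Nat.cast_sub (by lia)]; push_cast; ring]
      rw [← integral_pow_mul_exp_neg_sq]
      refine setIntegral_congr_fun measurableSet_Ioi fun r hr => ?_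
      rw [NNReal.smul_def, Real.coe_toNNReal _ (pow_nonneg (le_of_lt hr) _), smul_eq_mul, pow_add,
        mul_assoc]
    · exact (measurable_subtype_coe.pow_const _).real_toNNReal
  calc ∫ x : E, inner ℝ x y.1 ^ j * Real.exp (-‖x‖ ^ 2)
      = ∫ x : ({(0)}ᶜ : Set E), inner ℝ x.1 y.1 ^ j * Real.exp (-‖x.1‖ ^ 2)
          ∂((volume : Measure E).comap (↑)) := by
        rw [integral_subtype_comap (measurableSet_singleton _).compl
          fun x : E => inner ℝ x y.1 ^ j * Real.exp (-‖x‖ ^ 2), restrict_compl_singleton]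
    _ = ∫ z : Sph n × Set.Ioi (0 : ℝ),
          inner ℝ z.1.1 y.1 ^ j * (z.2.1 ^ j * Real.exp (-z.2.1 ^ 2))
          ∂((volume : Measure E).toSphere.prod (Measure.volumeIoiPow (n - 1))) := by
        have h := (volume : Measure E).measurePreserving_homeomorphUnitSphereProd.integral_comp
          (Homeomorph.measurableEmbedding _)
          (fun z => inner ℝ z.1.1 y.1 ^ j * (z.2.1 ^ j * Real.exp (-z.2.1 ^ 2)))
        rw [finrank_euclideanSpace_fin] at h
        rw [← h]
        refine integral_congr_ae (Filter.Eventually.of_forall fun x => ?_)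
        have hx : ‖x.1‖ ≠ 0 := norm_ne_zero_iff.2 x.2
        simp only [homeomorphUnitSphereProd_apply_fst_coe, homeomorphUnitSphereProd_apply_snd_coe,
          inner_smul_left, mul_pow]
        simp
        field_simp
    _ = _ := by
        rw [integral_prod_mul (fun x : Sph n => inner ℝ x.1 y.1 ^ j)
          (fun r : Set.Ioi (0 : ℝ) => r.1 ^ j * Real.exp (-r.1 ^ 2)), hr]

theorem hasFDerivAt_exp_neg_norm_sq {E : Type*} [NormedAddCommGroup E] [InnerProductSpace ℝ E]
    (x : E) : HasFDerivAt (fun x : E => Real.exp (-‖x‖ ^ 2))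
      (Real.exp (-‖x‖ ^ 2) • -((2 : ℕ) • (innerSL ℝ x : E →L[ℝ] ℝ))) x :=
  HasFDerivAt.exp (f := fun x : E => -‖x‖ ^ 2) (hasStrictFDerivAt_norm_sq x).hasFDerivAt.neg

theorem hasFDerivAt_inner_pow {E : Type*} [NormedAddCommGroup E] [InnerProductSpace ℝ E]
    (x y : E) (j : ℕ) : HasFDerivAt (fun x : E => inner ℝ x y ^ j)
      ((j * inner ℝ x y ^ (j - 1)) • innerSL ℝ y) x := by
  have h : HasFDerivAt (fun x : E => inner ℝ x y) (innerSL ℝ y) x := by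
    simpa [real_inner_comm] using (innerSL ℝ y).hasFDerivAt (x := x)
  simpa using h.pow j

/-- Integration by parts in the direction `y`, along which the Gaussian has derivative `-2 ⟨x, y⟩
exp(-‖x‖²)`. At `j = 0` the truncated exponent `j - 1` is harmless because of the factor `j`. -/
theorem integral_inner_pow_mul_exp_by_parts (hn : 3 ≤ n) (y : Sph n) (j : ℕ) :
    2 * ∫ x : EuclideanSpace ℝ (Fin n), inner ℝ x y.1 ^ (j + 1) * Real.exp (-‖x‖ ^ 2)
      = j * ∫ x : EuclideanSpace ℝ (Fin n), inner ℝ x y.1 ^ (j - 1) * Real.exp (-‖x‖ ^ 2) := by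
  have hy : inner ℝ y.1 y.1 = 1 := by simp
  have e1 : ∀ x, fderiv ℝ (fun x : EuclideanSpace ℝ (Fin n) => inner ℝ x y.1 ^ j) x y.1
      = j * inner ℝ x y.1 ^ (j - 1) := by
    intro x
    rw [(hasFDerivAt_inner_pow x y.1 j).fderiv]
    simp
  have e2 : ∀ x, fderiv ℝ (fun x : EuclideanSpace ℝ (Fin n) => Real.exp (-‖x‖ ^ 2)) x y.1
      = -2 * inner ℝ x y.1 * Real.exp (-‖x‖ ^ 2) := by
    intro x
    rw [(hasFDerivAt_exp_neg_norm_sq x).fderiv]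
    simp
    ring
  have h := integral_mul_fderiv_eq_neg_fderiv_mul_of_integrable
    (μ := (volume : Measure (EuclideanSpace ℝ (Fin n)))) (v := y.1)
    (f := fun x => inner ℝ x y.1 ^ j) (g := fun x => Real.exp (-‖x‖ ^ 2)) ?_ ?_ ?_ ?_ ?_
  · simp only [e1, e2] at h
    rw [← integral_const_mul, ← integral_const_mul, ← neg_inj, ← integral_neg]
    refine Eq.trans ?_ (h.trans ?_)
    · congr 1; ext x; ring
    · congr 2; ext x; ring
  · simp only [e1, mul_assoc]
    exact (integrable_inner_pow_mul_exp hn y (j - 1)).const_mul _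
  · simp only [e2]
    refine ((integrable_inner_pow_mul_exp hn y (j + 1)).const_mul (-2)).congr
      (Filter.Eventually.of_forall fun x => ?_)
    simp only
    ring
  · exact integrable_inner_pow_mul_exp hn y j
  · exact fun x _ => (hasFDerivAt_inner_pow x y.1 j).differentiableAt
  · exact fun x _ => (hasFDerivAt_exp_neg_norm_sq x).differentiableAt

theorem average_inner_pow_add_two (hn : 3 ≤ n) (y : Sph n) (j : ℕ) :
    ((n : ℝ) + j) * ⨍ x : Sph n, inner ℝ x.1 y.1 ^ (j + 2)
        ∂((volume : Measure (EuclideanSpace ℝ (Fin n))).toSphere)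
      = (j + 1) * ⨍ x : Sph n, inner ℝ x.1 y.1 ^ j
        ∂((volume : Measure (EuclideanSpace ℝ (Fin n))).toSphere) := by
  have h := integral_inner_pow_mul_exp_by_parts hn y (j + 1)
  have h3 : (3 : ℝ) ≤ n := by exact_mod_cast hn
  have hj := j.cast_nonneg (α := ℝ)
  have hp : 0 < ((n : ℝ) + j) / 2 := by linarith
  rw [Nat.add_sub_cancel, integral_inner_pow_mul_exp_eq hn, integral_inner_pow_mul_exp_eq hn,
    show ((n : ℝ) + (j + 1 + 1 : ℕ)) / 2 = (n + j) / 2 + 1 by push_cast; ring,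
    Real.Gamma_add_one hp.ne'] at h
  have hG := (Real.Gamma_pos_of_pos hp).ne'
  push_cast at h
  simp only [average_eq, smul_eq_mul]
  apply mul_left_cancel₀ hG
  linear_combination (((volume : Measure (EuclideanSpace ℝ (Fin n))).toSphere).real Set.univ)⁻¹
    * 2 * h

theorem average_inner (hn : 3 ≤ n) (y : Sph n) :
    ⨍ x : Sph n, inner ℝ x.1 y.1
        ∂((volume : Measure (EuclideanSpace ℝ (Fin n))).toSphere) = 0 := by
  have h := integral_inner_pow_mul_exp_by_parts hn y 0
  have h3 : (3 : ℝ) ≤ n := by exact_mod_cast hn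
  rw [integral_inner_pow_mul_exp_eq hn, Nat.cast_zero, zero_mul] at h
  have hG := (Real.Gamma_pos_of_pos (by push_cast; linarith : 0 < ((n : ℝ) + (0 + 1 : ℕ)) / 2)).ne'
  simp only [mul_eq_zero, hG, zero_add, pow_one] at h
  norm_num at h
  rw [average_eq, h, smul_zero]

/-- The spherical moments and those of `(1 - t²)^{(n-3)/2}` obey the same two-step recurrence with
initial values `1` and `0`, so the surface measure need not be projected explicitly. -/
theorem average_inner_pow (hn : 3 ≤ n) (y : Sph n) (j : ℕ) :
    ⨍ x : Sph n, inner ℝ x.1 y.1 ^ j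
        ∂((volume : Measure (EuclideanSpace ℝ (Fin n))).toSphere)
      = gegenbauerMean hn (X ^ j) := by
  have : Nonempty (Fin n) := ⟨⟨0, by lia⟩⟩
  have h3 : (3 : ℝ) ≤ n := by exact_mod_cast hn
  induction j using Nat.twoStepInduction with
  | zero =>
    have : NeZero (volume : Measure (EuclideanSpace ℝ (Fin n))).toSphere :=
      ⟨Measure.toSphere_ne_zero _⟩
    simp only [pow_zero, gegenbauerMean_one]
    exact average_const _ _
  | one => simpa [gegenbauerMean_X] using average_inner hn y
  | more j h1 _ =>
    have hj := j.cast_nonneg (α := ℝ)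
    apply mul_left_cancel₀ (by linarith : (n : ℝ) + j ≠ 0)
    rw [average_inner_pow_add_two hn, gegenbauerMean_X_pow_add_two, h1]

theorem average_eval_inner (hn : 3 ≤ n) (y : Sph n) (g : ℝ[X]) :
    ⨍ x : Sph n, g.eval (inner ℝ x.1 y.1)
        ∂((volume : Measure (EuclideanSpace ℝ (Fin n))).toSphere)
      = gegenbauerMean hn g := by
  conv_rhs => rw [g.as_sum_range_C_mul_X_pow]
  simp only [map_sum, gegenbauerMean_C_mul, ← average_inner_pow hn y, average_eq,
    eval_eq_sum_range, smul_eq_mul]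
  rw [integral_finsetSum]
  · simp only [integral_const_mul, Finset.mul_sum]
    exact Finset.sum_congr rfl fun i _ => by ring
  · intro i _
    exact Continuous.integrable_of_hasCompactSupport (by fun_prop)
      (HasCompactSupport.of_compactSpace _)

/-! ### Sums over designs -/

theorem IsDesign.sum_eval_inner (hn : 3 ≤ n) {τ : ℕ} {D : Finset (Sph n)} (hD : IsDesign τ D)
    {g : ℝ[X]} (hg : g.natDegree ≤ τ) (y : Sph n) :
    ∑ x ∈ D, g.eval (inner ℝ x.1 y.1) = D.card * gegenbauerMean hn g := by
  -- The linear form `⟨·, y⟩`; composing `g` with it gives a polynomial of total degree at most `τ`,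
  -- to which the design property applies.
  set L : MvPolynomial (Fin n) ℝ := ∑ i, MvPolynomial.C (y.1 i) * MvPolynomial.X i
  have hL : L.totalDegree ≤ 1 := by
    refine MvPolynomial.totalDegree_finsetSum_le fun i _ => ?_
    refine (MvPolynomial.totalDegree_mul _ _).trans ?_
    simp
  have hdeg : (aeval L g).totalDegree ≤ τ := by
    rw [aeval_eq_sum_range]
    refine MvPolynomial.totalDegree_finsetSum_le fun i hi => ?_
    refine (MvPolynomial.totalDegree_smul_le _ _).trans
      ((MvPolynomial.totalDegree_pow _ _).trans ?_)
    have : i ≤ τ := by simp at hi; lia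
    nlinarith
  have heval : ∀ x : Sph n, MvPolynomial.eval (fun i => x.1 i) (aeval L g)
      = g.eval (inner ℝ x.1 y.1) := by
    intro x
    rw [← MvPolynomial.coe_aeval_eq_eval, RingHom.coe_coe, ← aeval_algHom_apply,
      coe_aeval_eq_eval]
    congr 1
    simp [L, PiLp.inner_apply]
  have h := hD.2 _ hdeg
  simp only [heval] at h
  rw [average_eval_inner hn] at h
  have hc : (D.card : ℝ) ≠ 0 := by exact_mod_cast hD.1.card_pos.ne'
  rw [h]
  field_simp

theorem IsDesign.sum_offDiag (hn : 3 ≤ n) {τ : ℕ} {D : Finset (Sph n)} (hD : IsDesign τ D)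
    {g : ℝ[X]} (hg : g.natDegree ≤ τ) :
    ∑ p ∈ D.offDiag, g.eval (inner ℝ p.1.1 p.2.1)
      = (D.card : ℝ) ^ 2 * gegenbauerMean hn g - D.card * g.eval 1 := by
  classical
  have h1 : ∑ p ∈ D ×ˢ D, g.eval (inner ℝ p.1.1 p.2.1)
      = (D.card : ℝ) ^ 2 * gegenbauerMean hn g := by
    rw [Finset.sum_product_right]
    simp only [hD.sum_eval_inner hn hg, Finset.sum_const, nsmul_eq_mul]
    ring
  have h2 : ∑ p ∈ D.diag, g.eval (inner ℝ p.1.1 p.2.1) = D.card * g.eval 1 := by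
    rw [Finset.sum_diag]
    simp
  rw [← Finset.diag_union_offDiag, Finset.sum_union (Finset.disjoint_diag_offDiag D), h2] at h1
  linarith

/-! ### Zeros of quasi-orthogonal polynomials and interpolatory quadrature -/

/-- A quasi-orthogonal polynomial has no factor of degree two that is nonnegative on `(-1, 1)`. -/
theorem not_dvd_of_quasiOrthogonal (hn : 3 ≤ n) {W Q N : ℝ[X]} {k : ℕ} (hW0 : W ≠ 0)
    (hW : ∀ t ∈ Set.Ioo (-1 : ℝ) 1, 0 ≤ W.eval t) (hQ0 : Q ≠ 0) (hQ : Q.natDegree = k)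
    (horth : ∀ r : ℝ[X], r.natDegree + N.natDegree ≤ k → gegenbauerMean hn (W * Q * r) = 0)
    (hN : ∀ t ∈ Set.Ioo (-1 : ℝ) 1, 0 ≤ N.eval t) : ¬ N ∣ Q := by
  rintro ⟨S, rfl⟩
  have hN0 : N ≠ 0 := left_ne_zero_of_mul hQ0
  have hS0 : S ≠ 0 := right_ne_zero_of_mul hQ0
  rw [natDegree_mul hN0 hS0] at hQ
  have h := horth S (by lia)
  have hpos := gegenbauerMean_pos hn (p := W * (N * S) * S)
    (mul_ne_zero (mul_ne_zero hW0 hQ0) hS0) (fun t ht => by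
      have h1 := hW t ht
      have h2 := hN t ht
      rw [eval_mul, eval_mul, eval_mul]
      calc 0 ≤ W.eval t * N.eval t * (S.eval t) ^ 2 := by positivity
        _ = _ := by ring)
  exact hpos.ne' h

/-- A nonreal zero `z` would give the real factor `(t - Re z)² + (Im z)²`, which is nonnegative and
of degree two. -/
theorem splits_of_quasiOrthogonal (hn : 3 ≤ n) {W Q : ℝ[X]} {k : ℕ} (hW0 : W ≠ 0)
    (hW : ∀ t ∈ Set.Ioo (-1 : ℝ) 1, 0 ≤ W.eval t) (hQ0 : Q ≠ 0) (hQ : Q.natDegree = k)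
    (horth : ∀ r : ℝ[X], r.natDegree + 2 ≤ k → gegenbauerMean hn (W * Q * r) = 0) :
    Q.Splits := by
  refine Splits.of_splits_map (algebraMap ℝ ℂ) (IsAlgClosed.splits _) fun z hz => ?_
  have hz0 : aeval z Q = 0 := by
    rw [mem_roots_map hQ0] at hz
    exact hz
  by_contra hr
  have him : z.im ≠ 0 := fun h => hr ⟨z.re, Complex.ext (by simp) (by simp [h])⟩
  refine not_dvd_of_quasiOrthogonal hn hW0 hW hQ0 hQ ?_ ?_
    (Q.quadratic_dvd_of_aeval_eq_zero_im_ne_zero hz0 him)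
  · have : (X ^ 2 - C (2 * z.re) * X + C (‖z‖ ^ 2)).natDegree = 2 := by compute_degree!
    rw [this]
    exact horth
  · intro t _
    simp only [eval_add, eval_sub, eval_mul, eval_pow, eval_X, eval_C, Complex.sq_norm,
      Complex.normSq_apply]
    nlinarith [sq_nonneg (t - z.re), sq_nonneg z.im]

theorem roots_nodup_of_quasiOrthogonal (hn : 3 ≤ n) {W Q : ℝ[X]} {k : ℕ} (hW0 : W ≠ 0)
    (hW : ∀ t ∈ Set.Ioo (-1 : ℝ) 1, 0 ≤ W.eval t) (hQ0 : Q ≠ 0) (hQ : Q.natDegree = k)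
    (horth : ∀ r : ℝ[X], r.natDegree + 2 ≤ k → gegenbauerMean hn (W * Q * r) = 0) :
    Q.roots.Nodup := by
  rw [Multiset.nodup_iff_count_le_one]
  intro a
  by_contra! h
  rw [count_roots] at h
  refine not_dvd_of_quasiOrthogonal hn hW0 hW hQ0 hQ ?_ ?_ ((le_rootMultiplicity_iff hQ0).1 h)
  · rw [natDegree_pow, natDegree_X_sub_C]
    exact horth
  · intro t _
    rw [eval_pow]
    exact sq_nonneg _

theorem card_roots_of_quasiOrthogonal (hn : 3 ≤ n) {W Q : ℝ[X]} {k : ℕ} (hW0 : W ≠ 0)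
    (hW : ∀ t ∈ Set.Ioo (-1 : ℝ) 1, 0 ≤ W.eval t) (hQ0 : Q ≠ 0) (hQ : Q.natDegree = k)
    (horth : ∀ r : ℝ[X], r.natDegree + 2 ≤ k → gegenbauerMean hn (W * Q * r) = 0) :
    Q.roots.toFinset.card = k := by
  rw [Multiset.toFinset_card_of_nodup (roots_nodup_of_quasiOrthogonal hn hW0 hW hQ0 hQ horth),
    ← (splits_of_quasiOrthogonal hn hW0 hW hQ0 hQ horth).natDegree_eq_card_roots, hQ]

theorem eq_C_mul_nodal_of_quasiOrthogonal (hn : 3 ≤ n) {W Q : ℝ[X]} {k : ℕ} (hW0 : W ≠ 0)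
    (hW : ∀ t ∈ Set.Ioo (-1 : ℝ) 1, 0 ≤ W.eval t) (hQ0 : Q ≠ 0) (hQ : Q.natDegree = k)
    (horth : ∀ r : ℝ[X], r.natDegree + 2 ≤ k → gegenbauerMean hn (W * Q * r) = 0) :
    Q = C Q.leadingCoeff * Lagrange.nodal Q.roots.toFinset id := by
  have h := (splits_of_quasiOrthogonal hn hW0 hW hQ0 hQ horth).eq_prod_roots
  have hnd := roots_nodup_of_quasiOrthogonal hn hW0 hW hQ0 hQ horth
  conv_lhs => rw [h]
  rw [Lagrange.nodal_eq, Finset.prod, Multiset.toFinset_val, Multiset.dedup_eq_self.2 hnd]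
  simp

/-- A zero outside `(-1, 1)` gives a linear factor of constant sign there. Excluding a factor of
degree one takes orthogonality to one degree more than excluding a quadratic one. -/
theorem roots_mem_Ioo_of_orthogonal (hn : 3 ≤ n) {W Q : ℝ[X]} {k : ℕ} (hW0 : W ≠ 0)
    (hW : ∀ t ∈ Set.Ioo (-1 : ℝ) 1, 0 ≤ W.eval t) (hQ0 : Q ≠ 0) (hQ : Q.natDegree = k)
    (horth : ∀ r : ℝ[X], r.natDegree + 1 ≤ k → gegenbauerMean hn (W * Q * r) = 0)
    {a : ℝ} (ha : a ∈ Q.roots) : a ∈ Set.Ioo (-1 : ℝ) 1 := by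
  have hd : X - C a ∣ Q := dvd_iff_isRoot.2 ((mem_roots hQ0).1 ha)
  by_contra hmem
  rw [Set.mem_Ioo, not_and_or, not_lt, not_lt] at hmem
  rcases hmem with h | h
  · refine not_dvd_of_quasiOrthogonal hn hW0 hW hQ0 hQ ?_ ?_ hd
    · rw [natDegree_X_sub_C]
      exact horth
    · intro t ht
      simp only [eval_sub, eval_X, eval_C]
      linarith [ht.1]
  · refine not_dvd_of_quasiOrthogonal hn hW0 hW hQ0 hQ ?_ ?_ (neg_dvd.2 hd)
    · rw [natDegree_neg, natDegree_X_sub_C]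
      exact horth
    · intro t ht
      simp only [eval_neg, eval_sub, eval_X, eval_C]
      linarith [ht.2]

/-- Interpolatory quadrature at the nodes `T ∪ {1}`. -/
theorem gegenbauerMean_eq_sum_weight (hn : 3 ≤ n) {T : Finset ℝ} (hT : 1 ∉ T) {τ : ℕ}
    (horth : ∀ r : ℝ[X], r.natDegree + (T.card + 1) ≤ τ →
      gegenbauerMean hn (Lagrange.nodal (insert 1 T) id * r) = 0)
    {f : ℝ[X]} (hf : f.natDegree ≤ τ) :
    gegenbauerMean hn f = weight n T 1 * f.eval 1 + ∑ a ∈ T, weight n T a * f.eval a := by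
  set N : ℝ[X] := Lagrange.nodal (insert 1 T) id
  have hNm : N.Monic := Lagrange.nodal_monic
  have hNd : N.natDegree = T.card + 1 := by
    rw [Lagrange.natDegree_nodal, Finset.card_insert_of_notMem hT]
  -- Division by the nodal polynomial: the quotient has degree at most `τ - (T.card + 1)` and its
  -- contribution vanishes by `horth`; the remainder is the Lagrange interpolant of `f`.
  have h1 : gegenbauerMean hn f = gegenbauerMean hn (f %ₘ N) := by
    conv_lhs => rw [← modByMonic_add_div f N, map_add]
    have : gegenbauerMean hn (N * (f /ₘ N)) = 0 := by
      rcases lt_or_ge f.natDegree N.natDegree with hlt | hge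
      · rw [(divByMonic_eq_zero_iff hNm).2 (degree_lt_degree hlt), mul_zero, map_zero]
      · apply horth
        rw [natDegree_divByMonic f hNm]
        lia
    rw [this, add_zero]
  have h2 : f %ₘ N = ∑ a ∈ insert 1 T, C (f.eval a) * Lagrange.basis (insert 1 T) id a := by
    have hd : (f %ₘ N).degree < (insert 1 T).card := by
      have := degree_modByMonic_lt f hNm
      rwa [Lagrange.degree_nodal] at this
    rw [Lagrange.eq_interpolate (Set.injOn_id _) hd, Lagrange.interpolate_apply]
    refine Finset.sum_congr rfl fun a ha => ?_
    have : N.eval a = 0 := Lagrange.eval_nodal_at_node (v := id) ha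
    congr 2
    conv_rhs => rw [← modByMonic_add_div f N]
    simp [this]
  rw [h1, h2, map_sum, Finset.sum_insert hT]
  simp only [gegenbauerMean_C_mul]
  rw [mul_comm]
  congr 1
  exact Finset.sum_congr rfl fun a _ => mul_comm _ _

/-! ### Rolle's theorem and the error of Hermite interpolation -/

/-- Rolle between consecutive points of `S`, adding the points in increasing order. That each new
zero lies below some point of `S` keeps the zeros distinct in the induction; that it avoids `S` lets
double nodes be counted again later. The right endpoint stays excluded because `h` may be infinite
at `1`. -/
theorem exists_finset_deriv_eq_zero {F F' : ℝ → ℝ} {a b : ℝ} (hc : ContinuousOn F (Set.Ico a b))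
    (hd : ∀ x ∈ Set.Ioo a b, HasDerivAt F (F' x) x) (S : Finset ℝ) (hS : S.Nonempty)
    (hSm : ∀ x ∈ S, x ∈ Set.Ico a b) (hS0 : ∀ x ∈ S, F x = 0) :
    ∃ S' : Finset ℝ, S'.card + 1 = S.card ∧
      ∀ x ∈ S', x ∈ Set.Ioo a b ∧ F' x = 0 ∧ x ∉ S ∧ ∃ y ∈ S, x < y := by
  induction S using Finset.induction_on_max with
  | empty => simp at hS
  | insert c S hmax ih =>
    rcases S.eq_empty_or_nonempty with rfl | hne
    · exact ⟨∅, by simp⟩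
    obtain ⟨S', hcard, hS'⟩ := ih hne (fun x hx => hSm x (Finset.mem_insert_of_mem hx))
      (fun x hx => hS0 x (Finset.mem_insert_of_mem hx))
    set d := S.max' hne
    have hdS : d ∈ S := S.max'_mem hne
    have hdc := hmax d hdS
    have hda := hSm d (Finset.mem_insert_of_mem hdS)
    have hca := hSm c (Finset.mem_insert_self _ _)
    obtain ⟨e, he, he0⟩ := exists_hasDerivAt_eq_zero (f := F) (f' := F') hdc
      (hc.mono fun x hx => ⟨hda.1.trans hx.1, hx.2.trans_lt hca.2⟩)
      (by rw [hS0 d (Finset.mem_insert_of_mem hdS), hS0 c (Finset.mem_insert_self _ _)])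
      (fun x hx => hd x ⟨hda.1.trans_lt hx.1, hx.2.trans hca.2⟩)
    have heS : ∀ y ∈ S, y < e := fun y hy => (S.le_max' y hy).trans_lt he.1
    have heS' : e ∉ S' := fun h => by
      obtain ⟨-, -, -, y, hy, hxy⟩ := hS' e h
      exact absurd (heS y hy) hxy.not_gt
    refine ⟨insert e S', ?_, ?_⟩
    · rw [Finset.card_insert_of_notMem heS',
        Finset.card_insert_of_notMem fun h => (hmax c h).false, hcard]
    · intro x hx
      rcases Finset.mem_insert.1 hx with rfl | hx
      · refine ⟨⟨hda.1.trans_lt he.1, he.2.trans hca.2⟩, he0, ?_, c, Finset.mem_insert_self _ _,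
          he.2⟩
        rw [Finset.mem_insert, not_or]
        exact ⟨he.2.ne, fun h => (heS _ h).false⟩
      · obtain ⟨h1, h2, h3, y, hy, hxy⟩ := hS' x hx
        refine ⟨h1, h2, ?_, y, Finset.mem_insert_of_mem hy, hxy⟩
        rw [Finset.mem_insert, not_or]
        exact ⟨(hxy.trans (hmax y hy)).ne, h3⟩

theorem exists_iterated_deriv_eq_zero {F : ℕ → ℝ → ℝ} {a b : ℝ}
    (hc : ∀ j, ContinuousOn (F j) (Set.Ico a b))
    (hd : ∀ j, ∀ x ∈ Set.Ioo a b, HasDerivAt (F j) (F (j + 1) x) x) (m j : ℕ) (S : Finset ℝ)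
    (hcard : S.card = m + 1) (hSm : ∀ x ∈ S, x ∈ Set.Ico a b) (hS0 : ∀ x ∈ S, F j x = 0) :
    ∃ x ∈ Set.Ico a b, F (j + m) x = 0 := by
  induction m generalizing j S with
  | zero =>
    obtain ⟨x, hx⟩ := Finset.card_pos.1 (by lia : 0 < S.card)
    exact ⟨x, hSm x hx, hS0 x hx⟩
  | succ m ih =>
    obtain ⟨S', hc', hS'⟩ := exists_finset_deriv_eq_zero (hc j) (hd j) S
      (Finset.card_pos.1 (by lia)) hSm hS0
    obtain ⟨x, hx, h0⟩ := ih (j + 1) S' (by lia) (fun x hx => Set.Ioo_subset_Ico_self (hS' x hx).1)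
      (fun x hx => (hS' x hx).2.1)
    exact ⟨x, hx, by rw [← h0]; congr 1; ring⟩

/-- The polynomial with simple zeros at `S` and double zeros at `T`. -/
def hermiteNodal (S T : Finset ℝ) : ℝ[X] := Lagrange.nodal S id * Lagrange.nodal T id ^ 2

theorem hermiteNodal_monic (S T : Finset ℝ) : (hermiteNodal S T).Monic :=
  Lagrange.nodal_monic.mul (Lagrange.nodal_monic.pow 2)

theorem natDegree_hermiteNodal (S T : Finset ℝ) :
    (hermiteNodal S T).natDegree = S.card + 2 * T.card := by
  rw [hermiteNodal, Lagrange.nodal_monic.natDegree_mul (Lagrange.nodal_monic.pow 2), natDegree_pow,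
    Lagrange.natDegree_nodal, Lagrange.natDegree_nodal]

theorem iterate_derivative_natDegree {p : ℝ[X]} (hp : p.Monic) :
    derivative^[p.natDegree] p = C (p.natDegree.factorial : ℝ) := by
  have h := natDegree_iterate_derivative p p.natDegree
  rw [eq_C_of_natDegree_eq_zero (p := derivative^[p.natDegree] p) (by lia),
    coeff_iterate_derivative, zero_add,
    Nat.descFactorial_self, hp.coeff_natDegree, nsmul_eq_mul, mul_one]

/-- The error of Hermite interpolation of an absolutely monotone potential. -/
theorem AbsMonotone.exists_sub_eq_mul_hermiteNodal {h : ℝ → ℝ≥0∞} (hh : AbsMonotone h)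
    {S T : Finset ℝ} (hS : S.Nonempty) (hSm : ∀ x ∈ S, x ∈ Set.Ico (-1 : ℝ) 1)
    (hTm : ∀ x ∈ T, x ∈ Set.Ioo (-1 : ℝ) 1) (hST : Disjoint S T) {g : ℝ[X]}
    (hg : g.natDegree < S.card + 2 * T.card) (hi : Interpolates h S T g) {t : ℝ}
    (ht : t ∈ Set.Ico (-1 : ℝ) 1) :
    ∃ κ : ℝ, 0 ≤ κ ∧ (h t).toReal - g.eval t = κ * (hermiteNodal S T).eval t := by
  set H : ℝ → ℝ := fun t => (h t).toReal with hH
  set I := Set.Ico (-1 : ℝ) 1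
  set ω := hermiteNodal S T with hω
  have hnode : ∀ (U : Finset ℝ), ∀ x ∈ U, (Lagrange.nodal U id).eval x = 0 :=
    fun U x hx => Lagrange.eval_nodal_at_node (v := id) hx
  have hωS : ∀ x ∈ S, ω.eval x = 0 := fun x hx => by
    rw [hω, hermiteNodal, eval_mul, hnode S x hx, zero_mul]
  have hωT : ∀ x ∈ T, ω.eval x = 0 := fun x hx => by
    rw [hω, hermiteNodal, eval_mul, eval_pow, hnode T x hx]
    simp
  have hωT' : ∀ x ∈ T, (derivative ω).eval x = 0 := fun x hx => by
    rw [hω, hermiteNodal, derivative_mul, derivative_pow, eval_add, eval_mul, eval_mul, eval_mul,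
      eval_mul, eval_pow, eval_pow, hnode T x hx]
    simp
  by_cases htn : t ∈ S ∪ T
  · refine ⟨0, le_rfl, ?_⟩
    rw [zero_mul, sub_eq_zero]
    rcases Finset.mem_union.1 htn with h1 | h1
    · exact (hi.1 t h1).symm
    · exact (hi.2 t h1).1.symm
  have hωt : ω.eval t ≠ 0 := by
    rw [Finset.mem_union, not_or] at htn
    rw [hω, hermiteNodal, eval_mul, eval_pow]
    exact mul_ne_zero
      (Lagrange.eval_nodal_not_at_node fun i hi h => htn.1 (by rw [h]; exact hi))
      (pow_ne_zero _ (Lagrange.eval_nodal_not_at_node fun i hi h => htn.2 (by rw [h]; exact hi)))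
  -- With this `κ`, the polynomial `g + κ ω` agrees with `h` at `t` as well as at all nodes.
  set κ := (H t - g.eval t) / ω.eval t with hκ
  refine ⟨κ, ?_, by rw [hκ, div_mul_cancel₀ _ hωt]⟩
  have hU : UniqueDiffOn ℝ I := uniqueDiffOn_Ico _ _
  have hsm := hh.2.contDiffOn
  set p : ℝ[X] := g + C κ * ω with hp
  set F : ℕ → ℝ → ℝ := fun j x => iteratedDerivWithin j H I x - (derivative^[j] p).eval x with hF
  have hc : ∀ j, ContinuousOn (F j) I := fun j =>
    (hsm.continuousOn_iteratedDerivWithin (by exact_mod_cast le_top) hU).sub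
      (derivative^[j] p).continuous.continuousOn
  have hd : ∀ j, ∀ x ∈ Set.Ioo (-1 : ℝ) 1, HasDerivAt (F j) (F (j + 1) x) x := by
    intro j x hx
    have hI : I ∈ nhds x := Ico_mem_nhds hx.1 hx.2
    have h1 : DifferentiableWithinAt ℝ (iteratedDerivWithin j H I) I x :=
      hsm.differentiableOn_iteratedDerivWithin (by exact_mod_cast ENat.natCast_lt_top j) hU x
        (Set.Ioo_subset_Ico_self hx)
    have h2 : HasDerivAt (iteratedDerivWithin j H I) (iteratedDerivWithin (j + 1) H I x) x := by
      rw [iteratedDerivWithin_succ]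
      exact h1.hasDerivWithinAt.hasDerivAt hI
    refine (h2.sub ((derivative^[j] p).hasDerivAt x)).congr_deriv ?_
    rw [← Function.iterate_succ_apply' derivative]
  set Z := insert t (S ∪ T)
  have hZm : ∀ x ∈ Z, x ∈ I := by
    intro x hx
    rcases Finset.mem_insert.1 hx with rfl | hx
    · exact ht
    rcases Finset.mem_union.1 hx with hx | hx
    · exact hSm x hx
    · exact Set.Ioo_subset_Ico_self (hTm x hx)
  have hZ0 : ∀ x ∈ Z, F 0 x = 0 := by
    intro x hx
    simp only [hF, iteratedDerivWithin_zero, Function.iterate_zero, id_eq, hp, eval_add, eval_mul,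
      eval_C]
    rcases Finset.mem_insert.1 hx with rfl | hx
    · rw [hκ]
      field_simp
      ring
    rcases Finset.mem_union.1 hx with hx | hx
    · rw [hωS x hx, hi.1 x hx]
      ring
    · rw [hωT x hx, (hi.2 x hx).1]
      ring
  -- Rolle gives `S.card + T.card` zeros of the first derivative outside `Z`; the double nodes `T`
  -- are further ones, in total `S.card + 2 * T.card`.
  obtain ⟨Z', hZ'c, hZ'⟩ := exists_finset_deriv_eq_zero (hc 0) (hd 0) Z
    (Finset.insert_nonempty _ _) hZm hZ0
  have hdis : Disjoint Z' T := Finset.disjoint_left.2 fun x hx hxT =>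
    (hZ' x hx).2.2.1 (Finset.mem_insert_of_mem (Finset.mem_union_right _ hxT))
  have hcard : (Z' ∪ T).card = S.card + 2 * T.card := by
    rw [Finset.card_union_of_disjoint hdis]
    rw [Finset.card_insert_of_notMem htn, Finset.card_union_of_disjoint hST] at hZ'c
    lia
  have hSc := hS.card_pos
  obtain ⟨x, hx, hx0⟩ := exists_iterated_deriv_eq_zero hc hd (S.card + 2 * T.card - 1) 1 (Z' ∪ T)
    (by lia)
    (fun x hx => by
      rcases Finset.mem_union.1 hx with hx | hx
      · exact Set.Ioo_subset_Ico_self (hZ' x hx).1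
      · exact Set.Ioo_subset_Ico_self (hTm x hx))
    (fun x hx => by
      rcases Finset.mem_union.1 hx with hx | hx
      · exact (hZ' x hx).2.1
      · simp only [hF, iteratedDerivWithin_one, Function.iterate_one, hp, derivative_add,
          derivative_C_mul, eval_add, eval_mul, eval_C, hωT' x hx, (hi.2 x hx).2]
        rw [derivWithin_of_mem_nhds (Ico_mem_nhds (hTm x hx).1 (hTm x hx).2)]
        ring)
  rw [show 1 + (S.card + 2 * T.card - 1) = ω.natDegree by rw [natDegree_hermiteNodal]; lia] at hx0
  have hpd : derivative^[ω.natDegree] p = C (κ * (ω.natDegree.factorial : ℝ)) := by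
    rw [hp, iterate_map_add derivative, iterate_derivative_C_mul,
      iterate_derivative_natDegree (hermiteNodal_monic S T),
      iterate_derivative_eq_zero (by rw [natDegree_hermiteNodal]; exact hg), zero_add, C_mul]
  -- At the zero `x` of the derivative of order `N = deg ω`, this reads `κ N! = h^{(N)}(x) ≥ 0`.
  have hnn := hh.2.iteratedDerivWithin_nonneg hU ω.natDegree hx
  simp only [hF, hpd, eval_C, sub_eq_zero] at hx0
  rw [hx0] at hnn
  exact nonneg_of_mul_nonneg_left hnn (by positivity)

/-! ### Zeros of the adjacent polynomials -/

theorem one_sub_X_ne_zero : (1 - X : ℝ[X]) ≠ 0 := sub_ne_zero.2 (X_ne_C 1).symm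

theorem one_sub_X_sq_ne_zero : (1 - X ^ 2 : ℝ[X]) ≠ 0 := by
  have : (1 - X ^ 2 : ℝ[X]) = (1 - X) * (X + C 1) := by
    rw [C_1]
    ring
  rw [this]
  exact mul_ne_zero one_sub_X_ne_zero (X_add_C_ne_zero 1)

theorem one_sub_X_eval_nonneg : ∀ t ∈ Set.Ioo (-1 : ℝ) 1, 0 ≤ (1 - X : ℝ[X]).eval t := by
  intro t ht
  simp only [eval_sub, eval_one, eval_X]
  linarith [ht.2]

theorem one_sub_X_sq_eval_nonneg :
    ∀ t ∈ Set.Ioo (-1 : ℝ) 1, 0 ≤ (1 - X ^ 2 : ℝ[X]).eval t := by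
  intro t ht
  simp only [eval_sub, eval_one, eval_pow, eval_X]
  nlinarith [ht.1, ht.2]

theorem degree_lt_of_natDegree_succ_le {r : ℝ[X]} {k : ℕ} (h : r.natDegree + 1 ≤ k) :
    r.degree < k :=
  degree_le_natDegree.trans_lt (by exact_mod_cast h)

theorem adj_one_zero_ne_zero (k : ℕ) : adj n 1 0 k ≠ 0 := fun h => by
  simpa [h] using adj_one_zero_eval_one (n := n) k

theorem adj_one_one_ne_zero (k : ℕ) : adj n 1 1 k ≠ 0 := fun h => by
  simpa [h] using adj_one_one_eval_one (n := n) k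

theorem card_adjRoots_one_zero (hn : 3 ≤ n) (k : ℕ) : (adjRoots n 1 0 k).card = k :=
  card_roots_of_quasiOrthogonal hn one_sub_X_ne_zero one_sub_X_eval_nonneg
    (adj_one_zero_ne_zero k) (natDegree_adj_one_zero hn k) fun _ hr =>
      gegenbauerMean_adj_one_zero_mul hn (degree_lt_of_natDegree_succ_le (by lia))

theorem card_adjRoots_one_one (hn : 3 ≤ n) (k : ℕ) : (adjRoots n 1 1 k).card = k :=
  card_roots_of_quasiOrthogonal hn one_sub_X_sq_ne_zero one_sub_X_sq_eval_nonneg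
    (adj_one_one_ne_zero k) (natDegree_adj_one_one hn k) fun _ hr =>
      gegenbauerMean_adj_one_one_mul hn (degree_lt_of_natDegree_succ_le (by lia))

theorem adjRoots_one_zero_mem_Ioo (hn : 3 ≤ n) (k : ℕ) {t : ℝ} (ht : t ∈ adjRoots n 1 0 k) :
    t ∈ Set.Ioo (-1 : ℝ) 1 :=
  roots_mem_Ioo_of_orthogonal hn one_sub_X_ne_zero one_sub_X_eval_nonneg
    (adj_one_zero_ne_zero k) (natDegree_adj_one_zero hn k) (fun _ hr =>
      gegenbauerMean_adj_one_zero_mul hn (degree_lt_of_natDegree_succ_le hr))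
    (Multiset.mem_toFinset.1 ht)

theorem adjRoots_one_one_mem_Ioo (hn : 3 ≤ n) (k : ℕ) {t : ℝ} (ht : t ∈ adjRoots n 1 1 k) :
    t ∈ Set.Ioo (-1 : ℝ) 1 :=
  roots_mem_Ioo_of_orthogonal hn one_sub_X_sq_ne_zero one_sub_X_sq_eval_nonneg
    (adj_one_one_ne_zero k) (natDegree_adj_one_one hn k) (fun _ hr =>
      gegenbauerMean_adj_one_one_mul hn (degree_lt_of_natDegree_succ_le hr))
    (Multiset.mem_toFinset.1 ht)

/-- Reproducing property at `1`: `q - q(1)` is divisible by `X - 1`, and `P` is orthogonal to the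
quotient for the weight with the extra factor `1 - t`. -/
theorem gegenbauerMean_mul_eq_eval_one (hn : 3 ≤ n) {P q : ℝ[X]} {k : ℕ}
    (horth : ∀ r : ℝ[X], r.degree < k → gegenbauerMean hn ((1 - X) * P * r) = 0)
    (hq : q.natDegree ≤ k) :
    gegenbauerMean hn (P * q) = q.eval 1 * gegenbauerMean hn P := by
  obtain ⟨v, hv⟩ : X - C 1 ∣ q - C (q.eval 1) := by
    rw [dvd_iff_isRoot]
    simp
  have hvd : v.degree < k := by
    rcases eq_or_ne v 0 with rfl | hv0
    · simp
    · apply degree_lt_of_natDegree_succ_le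
      have h1 := congrArg natDegree hv
      rw [natDegree_sub_C, natDegree_mul (X_sub_C_ne_zero 1) hv0, natDegree_X_sub_C] at h1
      lia
  have h := horth v hvd
  have e : P * q = C (q.eval 1) * P - (1 - X) * P * v := by
    rw [C_1] at hv
    linear_combination P * hv
  rw [e, map_sub, h, sub_zero, gegenbauerMean_C_mul]

/-! ### Linear programming: `u` avoids the other interpolation nodes -/

theorem inner_mem_Icc (x y : Sph n) : inner ℝ x.1 y.1 ∈ Set.Icc (-1 : ℝ) 1 := by
  have := abs_real_inner_le_norm x.1 y.1
  simp only [norm_eq_of_mem_sphere, mul_one] at this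
  exact abs_le.1 this

/-- The linear programming inequality for designs with inner products at most `u`. -/
theorem IsDesign.card_mul_mean_le (hn : 3 ≤ n) {τ : ℕ} {D : Finset (Sph n)} (hD : IsDesign τ D)
    {u : ℝ} (hu : ∀ p ∈ D.offDiag, inner ℝ p.1.1 p.2.1 ≤ u) {f : ℝ[X]} (hf : f.natDegree ≤ τ)
    (hfu : ∀ t ∈ Set.Icc (-1 : ℝ) u, f.eval t ≤ 0) :
    D.card * gegenbauerMean hn f ≤ f.eval 1 := by
  have h := hD.sum_offDiag hn hf
  have hs : ∑ p ∈ D.offDiag, f.eval (inner ℝ p.1.1 p.2.1) ≤ 0 :=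
    Finset.sum_nonpos fun p hp => hfu _ ⟨(inner_mem_Icc p.1 p.2).1, hu p hp⟩
  have hc : (0 : ℝ) < D.card := by exact_mod_cast hD.1.card_pos
  rw [h] at hs
  nlinarith

theorem eval_one_pos_of_mul_eq {Q S : ℝ[X]} {u : ℝ} (hu : u < 1) (hQ : Q.eval 1 = 1)
    (h : Q = (X - C u) * S) : 0 < S.eval 1 := by
  rw [h, eval_mul, eval_sub, eval_X, eval_C] at hQ
  have : 0 < (1 - u) * S.eval 1 := by rw [hQ]; exact one_pos
  exact (mul_pos_iff_of_pos_left (by linarith)).1 this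

theorem natDegree_of_mul_eq {Q S : ℝ[X]} {u : ℝ} (hQ : Q ≠ 0) (h : Q = (X - C u) * S) :
    S.natDegree + 1 = Q.natDegree := by
  have hS : S ≠ 0 := by
    rintro rfl
    exact hQ (by rw [h, mul_zero])
  rw [h, natDegree_mul (X_sub_C_ne_zero u) hS, natDegree_X_sub_C, add_comm]

/-- If `P_m^{1,1} = (t - u) S`, then `f = (1 + t) P_m^{1,1} S = (1 + t)(t - u) S²` is `≤ 0` on `[-1,
u]`. By the reproducing property `f₀ = 2 S(1) / D(n, 2m+1)`, while `f(1) = 2 S(1) > 0`, so the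
design would have at most `D(n, 2m+1)` points. -/
theorem IsDesign.notMem_adjRoots_one_one (hn : 3 ≤ n) {m : ℕ} {D : Finset (Sph n)}
    (hD : IsDesign (2 * m + 1) D) (hM : dgs n (2 * m + 1) < D.card) {u : ℝ} (hu1 : u < 1)
    (hu : ∀ p ∈ D.offDiag, inner ℝ p.1.1 p.2.1 ≤ u) : u ∉ adjRoots n 1 1 m := by
  intro hmem
  obtain ⟨S, hS⟩ : X - C u ∣ adj n 1 1 m := by
    rw [dvd_iff_isRoot]
    exact (mem_roots (adj_one_one_ne_zero m)).1 (Multiset.mem_toFinset.1 hmem)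
  have hS1 := eval_one_pos_of_mul_eq hu1 (adj_one_one_eval_one m) hS
  have hSd := natDegree_of_mul_eq (adj_one_one_ne_zero m) hS
  rw [natDegree_adj_one_one hn] at hSd
  have hmean := gegenbauerMean_mul_eq_eval_one hn (P := (1 + X) * adj n 1 1 m) (q := S) (k := m)
    (fun r hr => by
      rw [← gegenbauerMean_adj_one_one_mul hn hr]
      congr 1
      ring) (by lia)
  have hle := hD.card_mul_mean_le hn hu (f := (1 + X) * adj n 1 1 m * S)
    (by
      refine natDegree_mul_le.trans ((add_le_add_left natDegree_mul_le _).trans ?_)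
      rw [natDegree_adj_one_one hn]
      have : (1 + X : ℝ[X]).natDegree ≤ 1 := by compute_degree
      lia)
    (fun t ht => by
      rw [hS]
      simp only [eval_mul, eval_add, eval_sub, eval_one, eval_X, eval_C]
      have h1 : 0 ≤ (1 + t) * (u - t) * (S.eval t) ^ 2 :=
        mul_nonneg (mul_nonneg (by linarith [ht.1]) (by linarith [ht.2])) (sq_nonneg _)
      nlinarith)
  have hD2 := gegenbauerMean_one_add_X_mul_adj_one_one hn m
  rw [hmean] at hle
  simp only [eval_mul, eval_add, eval_one, eval_X, adj_one_one_eval_one] at hle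
  set φ := gegenbauerMean hn ((1 + X) * adj n 1 1 m)
  have hM' : (dgs n (2 * m + 1) : ℝ) < D.card := by exact_mod_cast hM
  have hφ : 0 < φ := by
    by_contra! h
    have : (dgs n (2 * m + 1) : ℝ) * φ ≤ 0 := mul_nonpos_of_nonneg_of_nonpos (by positivity) h
    linarith
  have h2 : (dgs n (2 * m + 1) : ℝ) * φ < D.card * φ := mul_lt_mul_of_pos_right hM' hφ
  nlinarith

/-- The same argument with `f = P_k^{1,0} S = (t - u) S²` and the mean `1/D(n, 2k)`. -/
theorem IsDesign.notMem_adjRoots_one_zero (hn : 3 ≤ n) {k : ℕ} {D : Finset (Sph n)}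
    (hD : IsDesign (2 * k) D) (hM : dgs n (2 * k) < D.card) {u : ℝ} (hu1 : u < 1)
    (hu : ∀ p ∈ D.offDiag, inner ℝ p.1.1 p.2.1 ≤ u) : u ∉ adjRoots n 1 0 k := by
  intro hmem
  obtain ⟨S, hS⟩ : X - C u ∣ adj n 1 0 k := by
    rw [dvd_iff_isRoot]
    exact (mem_roots (adj_one_zero_ne_zero k)).1 (Multiset.mem_toFinset.1 hmem)
  have hS1 := eval_one_pos_of_mul_eq hu1 (adj_one_zero_eval_one k) hS
  have hSd := natDegree_of_mul_eq (adj_one_zero_ne_zero k) hS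
  rw [natDegree_adj_one_zero hn] at hSd
  have hmean := gegenbauerMean_mul_eq_eval_one hn (P := adj n 1 0 k) (q := S) (k := k)
    (fun r hr => gegenbauerMean_adj_one_zero_mul hn hr) (by lia)
  have hle := hD.card_mul_mean_le hn hu (f := adj n 1 0 k * S)
    (by
      refine natDegree_mul_le.trans ?_
      rw [natDegree_adj_one_zero hn]
      lia)
    (fun t ht => by
      rw [hS]
      simp only [eval_mul, eval_sub, eval_X, eval_C]
      have h1 : 0 ≤ (u - t) * (S.eval t) ^ 2 := mul_nonneg (by linarith [ht.2]) (sq_nonneg _)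
      nlinarith)
  have hD2 := gegenbauerMean_adj_one_zero hn k
  rw [hmean] at hle
  simp only [eval_mul, adj_one_zero_eval_one] at hle
  set φ := gegenbauerMean hn (adj n 1 0 k)
  have hM' : (dgs n (2 * k) : ℝ) < D.card := by exact_mod_cast hM
  have hφ : 0 < φ := by
    by_contra! h
    have : (dgs n (2 * k) : ℝ) * φ ≤ 0 := mul_nonpos_of_nonneg_of_nonpos (by positivity) h
    linarith
  have h2 : (dgs n (2 * k) : ℝ) * φ < D.card * φ := mul_lt_mul_of_pos_right hM' hφ
  nlinarith

theorem two_le_dgs_odd (hn : 3 ≤ n) (m : ℕ) : 2 ≤ dgs n (2 * m + 1) := by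
  have : 0 < (n + (2 * m + 1 + 1) / 2 - 2).choose (n - 1) := Nat.choose_pos (by lia)
  rw [dgs, if_neg (by simp)]
  lia

theorem IsDesign.ne_neg_one (hn : 3 ≤ n) {m : ℕ} {D : Finset (Sph n)}
    (hD : IsDesign (2 * m + 1) D) (hM : dgs n (2 * m + 1) < D.card) {u : ℝ}
    (hu : ∀ p ∈ D.offDiag, inner ℝ p.1.1 p.2.1 ≤ u) : u ≠ -1 := by
  rintro rfl
  have hle := hD.card_mul_mean_le hn hu (f := 1 + X)
    ((by compute_degree : (1 + X : ℝ[X]).natDegree ≤ 1).trans (by lia))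
    (fun t ht => by
      simp only [eval_add, eval_one, eval_X]
      linarith [ht.2])
  rw [map_add, gegenbauerMean_one, gegenbauerMean_X] at hle
  simp only [eval_add, eval_one, eval_X] at hle
  have : (2 : ℝ) < D.card := by exact_mod_cast (two_le_dgs_odd hn m).trans_lt hM
  linarith

/-! ### The energy bound and Levenshtein's quadrature rules -/

/-- The energy bound obtained from a polynomial majorant and a `1/M`-quadrature rule. -/
theorem maxEnergy_div_le_of_quadrature (hn : 3 ≤ n) {τ M : ℕ} (hM : 0 < M) {T : Finset ℝ}
    {h : ℝ → ℝ≥0∞} (hh : AbsMonotone h) {u : ℝ} (hu : u < 1) (hmax : maxInner n M τ ≤ (u : EReal))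
    {g : ℝ[X]} (hg : g.natDegree ≤ τ)
    (hquad : gegenbauerMean hn g = g.eval 1 / M + ∑ a ∈ T, weight n T a * g.eval a)
    (hdom : ∀ D : Finset (Sph n), IsDesign τ D → D.card = M →
      (∀ p ∈ D.offDiag, inner ℝ p.1.1 p.2.1 ≤ u) →
      ∀ t ∈ Set.Icc (-1 : ℝ) u, (h t).toReal ≤ g.eval t) :
    maxEnergy n M τ h / ((M : EReal) ^ 2) ≤
      ((ulb n M T h / (M : ℝ) ^ 2 + ∑ a ∈ T, weight n T a * (g.eval a - (h a).toReal) : ℝ)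
        : EReal) := by
  have hM0 : (0 : ℝ) < M := by exact_mod_cast hM
  have hr : ulb n M T h / (M : ℝ) ^ 2 + ∑ a ∈ T, weight n T a * (g.eval a - (h a).toReal)
      = ∑ a ∈ T, weight n T a * g.eval a := by
    rw [ulb, mul_div_cancel_left₀ _ (by positivity), ← Finset.sum_add_distrib]
    exact Finset.sum_congr rfl fun a _ => by ring
  rw [hr]
  have hMM : ((M : EReal) ^ 2) = (((M : ℝ) ^ 2 : ℝ) : EReal) := by
    rw [EReal.coe_pow]
    rfl
  rw [hMM, EReal.div_le_iff_le_mul (by exact_mod_cast (by positivity : (0 : ℝ) < (M : ℝ) ^ 2))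
    (EReal.coe_ne_top _), ← EReal.coe_mul]
  -- Without designs the supremum is `-∞` and nothing remains to be shown; this is why `hdom` may
  -- take a design `D` as given.
  refine iSup_le fun D => iSup_le fun hD => iSup_le fun hc => ?_
  have hpair : ∀ p ∈ D.offDiag, inner ℝ p.1.1 p.2.1 ≤ u := by
    intro p hp
    have h1 : ((inner ℝ p.1.1 p.2.1 : ℝ) : EReal) ≤ maxInner n M τ :=
      le_iSup_of_le D (le_iSup_of_le hD (le_iSup_of_le hc (le_iSup₂_of_le p hp le_rfl)))
    exact_mod_cast h1.trans hmax
  have hmem : ∀ p ∈ D.offDiag, inner ℝ p.1.1 p.2.1 ∈ Set.Icc (-1 : ℝ) u :=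
    fun p hp => ⟨(inner_mem_Icc p.1 p.2).1, hpair p hp⟩
  have hfin : ∀ p ∈ D.offDiag, h (inner ℝ p.1.1 p.2.1) ≠ ∞ :=
    fun p hp => hh.1 _ ⟨(hmem p hp).1, (hmem p hp).2.trans_lt hu⟩
  have hE : energy h D ≠ ∞ := ENNReal.sum_ne_top.2 hfin
  have hreal : (energy h D).toReal ≤ (M : ℝ) ^ 2 * ∑ a ∈ T, weight n T a * g.eval a := by
    rw [energy, ENNReal.toReal_sum hfin]
    calc ∑ p ∈ D.offDiag, (h (inner ℝ p.1.1 p.2.1)).toReal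
        ≤ ∑ p ∈ D.offDiag, g.eval (inner ℝ p.1.1 p.2.1) :=
          Finset.sum_le_sum fun p hp => hdom D hD hc hpair _ (hmem p hp)
      _ = _ := by
          rw [hD.sum_offDiag hn hg, hquad, hc]
          field_simp
          ring
  rw [← ENNReal.ofReal_toReal hE, EReal.coe_ennreal_ofReal, max_eq_left ENNReal.toReal_nonneg]
  exact_mod_cast hreal

theorem one_sub_mul_adj_one_zero_eval (hn : 3 ≤ n) (k : ℕ) (s : ℝ) :
    (2 * (k : ℝ) + n - 1) * ((1 - s) * (adj n 1 0 k).eval s)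
      = ((n : ℝ) - 1) * ((gegenbauer n k).eval s - (gegenbauer n (k + 1)).eval s) := by
  simpa using congrArg (eval s) (one_sub_X_mul_adj hn k)

/-- The equation `L_{2m+1}(n, s) = M` in terms of `P_m^{1,0}(s)` and `P_{m+1}^{(n)}(s)`. -/
theorem mul_gegenbauer_eq_of_levOdd_eq (hn : 3 ≤ n) {m M : ℕ} {s : ℝ} (hM : dgs n (2 * m + 1) < M)
    (hs : levOdd n (m + 1) s = M) :
    (gegenbauer n (m + 1)).eval s ≠ 0 ∧ (adj n 1 0 m).eval s ≠ 0 ∧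
      M * (gegenbauer n (m + 1)).eval s
        = dgs n (2 * m) * ((gegenbauer n (m + 1)).eval s - (adj n 1 0 m).eval s) := by
  have h3 : (3 : ℝ) ≤ n := by exact_mod_cast hn
  have hm := m.cast_nonneg (α := ℝ)
  have hn1 : (n : ℝ) - 1 ≠ 0 := by linarith
  have hc : m + 1 + n - 3 = m + n - 2 := by lia
  have hD := cast_dgs_even hn m
  have hDo := cast_dgs_odd hn m
  have hcr := choose_recurrence hn m
  have hMr : (dgs n (2 * m + 1) : ℝ) < M := by exact_mod_cast hM
  have hG := one_sub_mul_adj_one_zero_eval hn m s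
  rw [levOdd, hc, Nat.add_sub_cancel] at hs
  push_cast at hs
  set c : ℝ := ((m + n - 2).choose m : ℝ)
  have hc0 : 0 < c := Nat.cast_pos.2 (Nat.choose_pos (by lia))
  set P := (gegenbauer n (m + 1)).eval s
  set A := (gegenbauer n m).eval s
  set G := (adj n 1 0 m).eval s
  have hDM : (dgs n (2 * m) : ℝ) < M := by
    refine lt_trans ?_ hMr
    have : (dgs n (2 * m) : ℝ) * (n - 1) < dgs n (2 * m + 1) * (n - 1) := by
      rw [hD, hDo]
      nlinarith
    exact lt_of_mul_lt_mul_right this (by linarith)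
  have hcD : c * ((2 * ((m : ℝ) + 1) + n - 3) / (n - 1)) = dgs n (2 * m) := by
    rw [← mul_div_assoc, div_eq_iff hn1, hD]
    ring
  -- Division by zero returns `0`, so a vanishing denominator would give `L_{2m+1}(n, s) = D(n, 2m)
  -- < M`.
  have hden : (1 - s) * P ≠ 0 := by
    intro h0
    rw [h0, div_zero, sub_zero, hcD] at hs
    exact hDM.ne hs
  have hP : P ≠ 0 := right_ne_zero_of_mul hden
  have h1s : 1 - s ≠ 0 := left_ne_zero_of_mul hden
  have hAP : c * (A - P) = dgs n (2 * m) * ((1 - s) * G) := by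
    apply mul_left_cancel₀ hn1
    linear_combination -c * hG - ((1 - s) * G) * hD
  have hmain : (M : ℝ) * P = dgs n (2 * m) * (P - G) := by
    rw [mul_sub, hcD, ← mul_div_assoc, hAP] at hs
    rw [← hs]
    field_simp
  refine ⟨hP, fun h0 => ?_, hmain⟩
  rw [h0, sub_zero] at hmain
  exact hDM.ne' (mul_right_cancel₀ hP hmain)

theorem natDegree_sub_of_eq_succ {a b : ℝ} {P Q : ℝ[X]} {m : ℕ} (ha : a ≠ 0)
    (hP : P.natDegree = m + 1) (hQ : Q.natDegree = m) :
    (C a * P - C b * Q).natDegree = m + 1 := by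
  have h1 : (C a * P).natDegree = m + 1 := by rw [natDegree_C_mul ha, hP]
  rw [natDegree_sub_eq_left_of_natDegree_lt, h1]
  rw [h1]
  exact (natDegree_C_mul_le _ _).trans_lt (by lia)

/-- Levenshtein's `1/M`-quadrature rule in odd degree. -/
theorem quadrature_nodesOdd (hn : 3 ≤ n) {m M : ℕ} {s : ℝ} (hM : dgs n (2 * m + 1) < M)
    (hs : levOdd n (m + 1) s = M) {f : ℝ[X]} (hf : f.natDegree ≤ 2 * m + 1) :
    gegenbauerMean hn f = f.eval 1 / M
      + ∑ a ∈ nodesOdd n (m + 1) s, weight n (nodesOdd n (m + 1) s) a * f.eval a := by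
  obtain ⟨hP, hG, hmain⟩ := mul_gegenbauer_eq_of_levOdd_eq hn hM hs
  have hM0 : (M : ℝ) ≠ 0 := by
    have : 0 < M := by lia
    positivity
  set Q := nodePoly n 0 (m + 1) s with hQdef
  have hQ : Q = C ((adj n 1 0 m).eval s) * adj n 1 0 (m + 1)
      - C ((adj n 1 0 (m + 1)).eval s) * adj n 1 0 m := rfl
  have hQd : Q.natDegree = m + 1 := by
    rw [hQ]
    exact natDegree_sub_of_eq_succ hG (natDegree_adj_one_zero hn _) (natDegree_adj_one_zero hn _)
  have hQ0 : Q ≠ 0 := by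
    intro h
    simp [h] at hQd
  -- Both terms of `Q` are orthogonal to degree below `m`, one less than full orthogonality for
  -- degree `m + 1`; this still suffices for real simple zeros.
  have horth : ∀ r : ℝ[X], r.natDegree + 1 ≤ m → gegenbauerMean hn ((1 - X) * Q * r) = 0 := by
    intro r hr
    have e : (1 - X) * Q * r
        = C ((adj n 1 0 m).eval s) * ((1 - X) * adj n 1 0 (m + 1) * r)
          - C ((adj n 1 0 (m + 1)).eval s) * ((1 - X) * adj n 1 0 m * r) := by
      rw [hQ]
      ring
    rw [e, map_sub, gegenbauerMean_C_mul, gegenbauerMean_C_mul,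
      gegenbauerMean_adj_one_zero_mul hn (degree_lt_of_natDegree_succ_le (by lia)),
      gegenbauerMean_adj_one_zero_mul hn (degree_lt_of_natDegree_succ_le hr)]
    ring
  have horth' : ∀ r : ℝ[X], r.natDegree + 2 ≤ m + 1 →
      gegenbauerMean hn ((1 - X) * Q * r) = 0 := fun r hr => horth r (by lia)
  have hkey := dgs_mul_adj_one_zero_succ_sub hn m
  set r := ((m + 1 + n - 2).choose (m + 1) : ℝ) + ((m + n - 2).choose m : ℝ) with hr
  have hr0 : r ≠ 0 := by
    have : 0 < (m + n - 2).choose m := Nat.choose_pos (by lia)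
    positivity
  have hk1 := congrArg (eval 1) hkey
  have hks := congrArg (eval s) hkey
  simp only [eval_sub, eval_mul, eval_C, adj_one_zero_eval_one, gegenbauer_eval_one hn,
    mul_one] at hk1 hks
  have hφ0 := gegenbauerMean_adj_one_zero hn m
  have hφ1 := gegenbauerMean_adj_one_zero hn (m + 1)
  have hQ1 : Q.eval 1 = (adj n 1 0 m).eval s - (adj n 1 0 (m + 1)).eval s := by
    rw [hQ]
    simp [adj_one_zero_eval_one]
  have hQm : gegenbauerMean hn Q = (adj n 1 0 m).eval s * gegenbauerMean hn (adj n 1 0 (m + 1))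
      - (adj n 1 0 (m + 1)).eval s * gegenbauerMean hn (adj n 1 0 m) := by
    rw [hQ, map_sub, gegenbauerMean_C_mul, gegenbauerMean_C_mul]
  set P := (gegenbauer n (m + 1)).eval s
  set G0 := (adj n 1 0 m).eval s
  set G1 := (adj n 1 0 (m + 1)).eval s
  set φ0 := gegenbauerMean hn (adj n 1 0 m)
  set φ1 := gegenbauerMean hn (adj n 1 0 (m + 1))
  set D0 := (dgs n (2 * m) : ℝ)
  set D1 := (dgs n (2 * (m + 1)) : ℝ)
  have hD0 : D0 ≠ 0 := left_ne_zero_of_mul (by rw [hφ0]; exact one_ne_zero)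
  have hD1 : D1 ≠ 0 := left_ne_zero_of_mul (by rw [hφ1]; exact one_ne_zero)
  have hQ1' : D0 * D1 * Q.eval 1 = -(r * M * P) := by
    rw [hQ1]
    linear_combination D0 * G0 * hk1 - D0 * hks + r * hmain
  have hQ1ne : Q.eval 1 ≠ 0 := by
    intro h0
    rw [h0, mul_zero] at hQ1'
    exact neg_ne_zero.2 (mul_ne_zero (mul_ne_zero hr0 hM0) hP) hQ1'.symm
  -- The means of the two adjacent polynomials are `1/D0` and `1/D1`; the equation for `s` then
  -- gives `Q₀ = Q(1)/M`.
  have hQM : M * gegenbauerMean hn Q = Q.eval 1 := by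
    apply mul_left_cancel₀ (mul_ne_zero hD0 hD1)
    rw [hQ1', hQm]
    linear_combination M * D0 * G0 * hφ1 - M * D1 * G1 * hφ0 - M * hks
  have hcard := card_roots_of_quasiOrthogonal hn one_sub_X_ne_zero one_sub_X_eval_nonneg hQ0 hQd
    horth'
  have hnodal := eq_C_mul_nodal_of_quasiOrthogonal hn one_sub_X_ne_zero one_sub_X_eval_nonneg hQ0
    hQd horth'
  have hT : nodesOdd n (m + 1) s = Q.roots.toFinset := rfl
  rw [hT]
  set T := Q.roots.toFinset with hTdef
  have h1T : (1 : ℝ) ∉ T := fun h => hQ1ne ((mem_roots hQ0).1 (Multiset.mem_toFinset.1 h))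
  have hquad : ∀ f : ℝ[X], f.natDegree ≤ 2 * m + 1 → gegenbauerMean hn f
      = weight n T 1 * f.eval 1 + ∑ a ∈ T, weight n T a * f.eval a := by
    intro f hf
    refine gegenbauerMean_eq_sum_weight hn h1T (fun q hq => ?_) hf
    rw [hcard] at hq
    have h := horth q (by lia)
    rw [hnodal] at h
    have e : (1 - X) * (C Q.leadingCoeff * Lagrange.nodal T id) * q
        = C (-Q.leadingCoeff) * (Lagrange.nodal (insert 1 T) id * q) := by
      rw [Lagrange.nodal_insert_eq_nodal h1T, id_eq, C_1, C_neg]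
      ring
    rw [e, gegenbauerMean_C_mul] at h
    exact (mul_eq_zero.1 h).resolve_left (neg_ne_zero.2 (leadingCoeff_ne_zero.2 hQ0))
  -- Test the rule on `Q`, which vanishes at every node except `1`.
  have hw : weight n T 1 = 1 / M := by
    have h := hquad Q (by lia)
    rw [Finset.sum_eq_zero, add_zero] at h
    · rw [h] at hQM
      rw [eq_div_iff hM0]
      apply mul_right_cancel₀ hQ1ne
      linear_combination hQM
    · intro a ha
      rw [(mem_roots hQ0).1 (Multiset.mem_toFinset.1 ha), mul_zero]
  rw [hquad f hf, hw]
  ring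

/-- The equation `L_{2k}(n, s) = M` in terms of `x = P_k^{(n)}(s) + P_{k+1}^{(n)}(s)` and
`y = (2k + n - 1) (1 + s) P_k^{1,0}(s)`. -/
theorem mul_gegenbauer_eq_of_levEven_eq (hn : 3 ≤ n) {k M : ℕ} {s : ℝ} (hM : dgs n (2 * k) < M)
    (hs : levEven n k s = M) :
    (gegenbauer n k).eval s + (gegenbauer n (k + 1)).eval s ≠ 0 ∧
      ((n : ℝ) - 1) * M * ((gegenbauer n k).eval s + (gegenbauer n (k + 1)).eval s)
        = (k + n - 2).choose k * ((2 * k + n - 1)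
            * ((gegenbauer n k).eval s + (gegenbauer n (k + 1)).eval s)
          - (2 * k + n - 1) * ((1 + s) * (adj n 1 0 k).eval s)) := by
  have h3 : (3 : ℝ) ≤ n := by exact_mod_cast hn
  have hn1 : (n : ℝ) - 1 ≠ 0 := by linarith
  have hD := cast_dgs_even hn k
  have hMr : (dgs n (2 * k) : ℝ) < M := by exact_mod_cast hM
  have hG := one_sub_mul_adj_one_zero_eval hn k s
  rw [levEven] at hs
  set c : ℝ := ((k + n - 2).choose k : ℝ)
  set P := (gegenbauer n (k + 1)).eval s
  set A := (gegenbauer n k).eval s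
  set G := (adj n 1 0 k).eval s
  have hcD : c * ((2 * (k : ℝ) + n - 1) / (n - 1)) = dgs n (2 * k) := by
    rw [← mul_div_assoc, div_eq_iff hn1, hD]
    ring
  have hden : (1 - s) * (A + P) ≠ 0 := by
    intro h0
    rw [h0, div_zero, sub_zero, hcD] at hs
    exact hMr.ne hs
  have hx : A + P ≠ 0 := right_ne_zero_of_mul hden
  have h1s : 1 - s ≠ 0 := left_ne_zero_of_mul hden
  refine ⟨hx, ?_⟩
  have h1 : (2 * (k : ℝ) + n - 1) / (n - 1) * (n - 1) = 2 * k + n - 1 := div_mul_cancel₀ _ hn1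
  have h2 : (1 + s) * (A - P) / ((1 - s) * (A + P)) * ((1 - s) * (A + P)) = (1 + s) * (A - P) :=
    div_mul_cancel₀ _ hden
  apply mul_left_cancel₀ h1s
  linear_combination -((n : ℝ) - 1) * (1 - s) * (A + P) * hs + c * (1 - s) * (A + P) * h1
    - c * (n - 1) * h2 + c * (1 + s) * hG

/-- Levenshtein's `1/M`-quadrature rule in even degree. -/
theorem quadrature_nodesEven (hn : 3 ≤ n) {m M : ℕ} {s : ℝ} (hM : dgs n (2 * (m + 1)) < M)
    (hs : levEven n (m + 1) s = M) {f : ℝ[X]} (hf : f.natDegree ≤ 2 * (m + 1)) :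
    gegenbauerMean hn f = f.eval 1 / M
      + ∑ a ∈ nodesEven n (m + 1) s, weight n (nodesEven n (m + 1) s) a * f.eval a := by
  have h3 : (3 : ℝ) ≤ n := by exact_mod_cast hn
  have hm := m.cast_nonneg (α := ℝ)
  have hN : (n : ℝ) - 1 ≠ 0 := by linarith
  have hm1 : (m : ℝ) + 1 ≠ 0 := by linarith
  have hmn : (m : ℝ) + n ≠ 0 := by linarith
  obtain ⟨hx, hmain⟩ := mul_gegenbauer_eq_of_levEven_eq hn hM hs
  have hM0 : (M : ℝ) ≠ 0 := by
    have : 0 < M := by lia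
    positivity
  have hDc := cast_dgs_even hn (m + 1)
  have hMr : (dgs n (2 * (m + 1)) : ℝ) < M := by exact_mod_cast hM
  have hH1 := congrArg (eval s) (one_add_X_mul_adj_one_one hn (m + 1))
  have hH0 := congrArg (eval s) (one_add_X_mul_adj_one_one' hn m)
  have hφ1 := gegenbauerMean_one_add_X_mul_adj_one_one hn (m + 1)
  have hφ0 := gegenbauerMean_one_add_X_mul_adj_one_one hn m
  have hD1 := cast_dgs_odd hn (m + 1)
  have hD0 := cast_dgs_odd hn m
  have hcr := choose_recurrence hn (m + 1)
  set Q := nodePoly n 1 (m + 1) s with hQdef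
  have hQ : Q = C ((adj n 1 1 m).eval s) * adj n 1 1 (m + 1)
      - C ((adj n 1 1 (m + 1)).eval s) * adj n 1 1 m := rfl
  have hQ1 : Q.eval 1 = (adj n 1 1 m).eval s - (adj n 1 1 (m + 1)).eval s := by
    rw [hQ]
    simp [adj_one_one_eval_one]
  have hQn1 : Q.eval (-1)
      = -(-1) ^ m * ((adj n 1 1 m).eval s + (adj n 1 1 (m + 1)).eval s) := by
    rw [hQ]
    simp only [eval_sub, eval_mul, eval_C, adj_one_one_eval_neg_one hn]
    ring
  have hQm : gegenbauerMean hn ((1 + X) * Q)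
      = (adj n 1 1 m).eval s * gegenbauerMean hn ((1 + X) * adj n 1 1 (m + 1))
      - (adj n 1 1 (m + 1)).eval s * gegenbauerMean hn ((1 + X) * adj n 1 1 m) := by
    rw [← gegenbauerMean_C_mul, ← gegenbauerMean_C_mul, ← map_sub, hQ]
    congr 1
    ring
  simp only [eval_sub, eval_add, eval_mul, eval_C, eval_one, eval_X] at hH1 hH0
  set c : ℝ := ((m + 1 + n - 2).choose (m + 1) : ℝ)
  have hc0 : 0 < c := Nat.cast_pos.2 (Nat.choose_pos (by lia))
  set x := (gegenbauer n (m + 1)).eval s + (gegenbauer n (m + 1 + 1)).eval s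
  set G := (adj n 1 0 (m + 1)).eval s
  set H0 := (adj n 1 1 m).eval s
  set H1 := (adj n 1 1 (m + 1)).eval s
  set φ0 := gegenbauerMean hn ((1 + X) * adj n 1 1 m)
  set φ1 := gegenbauerMean hn ((1 + X) * adj n 1 1 (m + 1))
  set D := (dgs n (2 * (m + 1)) : ℝ)
  push_cast at hH1 hH0 hmain hDc hD1 hcr
  set y := (1 + s) * G with hy
  -- Such an equality would give `M ≤ D(n, 2(m+1))`. Each degeneracy below implies one: `H0 = 0`
  -- (drop of degree) with `a = n - 1`, `y = 0` (so in particular `s = -1`) with `a = 0`, and `Q(-1)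
  -- = 0` (repeated node) with `a = (n - 1)² / (2(m + 1) + n - 1)`.
  have hMx : ∀ a : ℝ, 0 ≤ a → ((n : ℝ) - 1) * M * x ≠ c * (2 * (m + 1) + n - 1 - a) * x := by
    intro a ha h
    have h' := mul_right_cancel₀ hx h
    nlinarith [mul_nonneg hc0.le ha, mul_pos (sub_pos.2 hMr) (by linarith : (0 : ℝ) < n - 1)]
  have hH0ne : H0 ≠ 0 := by
    intro h0
    refine hMx (n - 1) (by linarith) ?_
    rw [h0] at hH0
    linear_combination hmain + c * hH0
  have hy0 : y ≠ 0 := by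
    intro h0
    refine hMx 0 le_rfl ?_
    linear_combination hmain + c * (2 * (m + 1) + n - 1) * (-h0)
  have h1s : 1 + s ≠ 0 := left_ne_zero_of_mul hy0
  have hQn1ne : Q.eval (-1) ≠ 0 := by
    rw [hQn1]
    refine mul_ne_zero (neg_ne_zero.2 (pow_ne_zero _ (by norm_num))) fun h0 => ?_
    have hE : 2 * ((m : ℝ) + 1) + n - 1 ≠ 0 := by linarith
    obtain ⟨a, ha⟩ : ∃ a, (2 * ((m : ℝ) + 1) + n - 1) * a = (n - 1) ^ 2 :=
      ⟨(n - 1) ^ 2 / (2 * (m + 1) + n - 1), mul_div_cancel₀ _ hE⟩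
    refine hMx a ?_ (mul_left_cancel₀ hE ?_)
    · have : 0 ≤ (2 * ((m : ℝ) + 1) + n - 1) * a := by rw [ha]; positivity
      exact nonneg_of_mul_nonneg_right this (by linarith)
    · linear_combination (2 * ((m : ℝ) + 1) + n - 1) * hmain + c * x * ha
        + c * (m + 1) * hH1 + c * (m + n) * hH0 - 2 * c * (m + 1) * (m + n) * (1 + s) * h0
  have hQ1eq : 2 * ((m : ℝ) + 1) * (m + n) * ((1 + s) * Q.eval 1) * c
      = -((n : ℝ) - 1) ^ 2 * M * x := by
    rw [hQ1]
    linear_combination c * (m + n) * hH0 - c * (m + 1) * hH1 + ((n : ℝ) - 1) * hmain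
  have hQ1ne : Q.eval 1 ≠ 0 := by
    intro h0
    rw [h0, mul_zero, mul_zero, zero_mul] at hQ1eq
    exact mul_ne_zero (mul_ne_zero (neg_ne_zero.2 (pow_ne_zero 2 hN)) hM0) hx hQ1eq.symm
  have hφ0' : ((m : ℝ) + 1) * c * φ0 = n - 1 := by
    linear_combination (-φ0 * hD0 + (n - 1) * hφ0) / 2
  have hφ1' : ((m : ℝ) + n) * c * φ1 = n - 1 := by
    linear_combination -φ1 * hcr + (-φ1 * hD1 + (n - 1) * hφ1) / 2
  -- The test function is now `(1 + X) Q`: it vanishes at `-1` and at the zeros of `Q`, and equals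
  -- `2 Q(1)` at `1`.
  have hQM : M * gegenbauerMean hn ((1 + X) * Q) = 2 * Q.eval 1 := by
    apply mul_left_cancel₀ (mul_ne_zero (mul_ne_zero (mul_ne_zero hm1 hmn) hc0.ne') h1s)
    rw [hQm]
    linear_combination M * (1 + s) * (m + 1) * H0 * hφ1' - M * (1 + s) * (m + n) * H1 * hφ0'
      + M * (n - 1) / 2 * (hH0 - hH1) - hQ1eq
  have hQd : Q.natDegree = m + 1 := by
    rw [hQ]
    exact natDegree_sub_of_eq_succ hH0ne (natDegree_adj_one_one hn _) (natDegree_adj_one_one hn _)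
  have hQ0 : Q ≠ 0 := by
    intro h
    simp [h] at hQd
  have horth : ∀ r : ℝ[X], r.natDegree + 1 ≤ m → gegenbauerMean hn ((1 - X ^ 2) * Q * r) = 0 := by
    intro r hr
    have e : (1 - X ^ 2) * Q * r
        = C H0 * ((1 - X ^ 2) * adj n 1 1 (m + 1) * r)
          - C H1 * ((1 - X ^ 2) * adj n 1 1 m * r) := by
      rw [hQ]
      ring
    rw [e, map_sub, gegenbauerMean_C_mul, gegenbauerMean_C_mul,
      gegenbauerMean_adj_one_one_mul hn (degree_lt_of_natDegree_succ_le (by lia)),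
      gegenbauerMean_adj_one_one_mul hn (degree_lt_of_natDegree_succ_le hr)]
    ring
  have horth' : ∀ r : ℝ[X], r.natDegree + 2 ≤ m + 1 →
      gegenbauerMean hn ((1 - X ^ 2) * Q * r) = 0 := fun r hr => horth r (by lia)
  have hcard := card_roots_of_quasiOrthogonal hn one_sub_X_sq_ne_zero one_sub_X_sq_eval_nonneg
    hQ0 hQd horth'
  have hnodal := eq_C_mul_nodal_of_quasiOrthogonal hn one_sub_X_sq_ne_zero
    one_sub_X_sq_eval_nonneg hQ0 hQd horth'
  have hT : nodesEven n (m + 1) s = insert (-1) Q.roots.toFinset := rfl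
  rw [hT]
  set R := Q.roots.toFinset with hRdef
  have hR : ∀ a ∈ R, Q.eval a = 0 := fun a ha => (mem_roots hQ0).1 (Multiset.mem_toFinset.1 ha)
  have hn1R : (-1 : ℝ) ∉ R := fun h => hQn1ne (hR _ h)
  set T := insert (-1) R with hTdef
  have h1T : (1 : ℝ) ∉ T := by
    rw [hTdef, Finset.mem_insert, not_or]
    exact ⟨by norm_num, fun h => hQ1ne (hR _ h)⟩
  have hTc : T.card = m + 2 := by rw [hTdef, Finset.card_insert_of_notMem hn1R, hcard]
  have hquad : ∀ f : ℝ[X], f.natDegree ≤ 2 * (m + 1) → gegenbauerMean hn f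
      = weight n T 1 * f.eval 1 + ∑ a ∈ T, weight n T a * f.eval a := by
    intro f hf
    refine gegenbauerMean_eq_sum_weight hn h1T (fun q hq => ?_) hf
    have h := horth q (by lia)
    rw [hnodal] at h
    have e : (1 - X ^ 2) * (C Q.leadingCoeff * Lagrange.nodal R id) * q
        = C (-Q.leadingCoeff) * (Lagrange.nodal (insert 1 T) id * q) := by
      rw [Lagrange.nodal_insert_eq_nodal h1T, hTdef, Lagrange.nodal_insert_eq_nodal hn1R, id_eq,
        id_eq, C_neg, C_neg, C_1]
      ring
    rw [e, gegenbauerMean_C_mul] at h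
    exact (mul_eq_zero.1 h).resolve_left (neg_ne_zero.2 (leadingCoeff_ne_zero.2 hQ0))
  have hw : weight n T 1 = 1 / M := by
    have h := hquad ((1 + X) * Q) (by
      refine natDegree_mul_le.trans ?_
      have : (1 + X : ℝ[X]).natDegree ≤ 1 := by compute_degree
      lia)
    rw [Finset.sum_eq_zero, add_zero] at h
    · rw [h] at hQM
      simp only [eval_mul, eval_add, eval_one, eval_X] at hQM
      rw [eq_div_iff hM0]
      apply mul_right_cancel₀ hQ1ne
      linear_combination hQM / 2
    · intro a ha
      rw [eval_mul]
      rcases Finset.mem_insert.1 ha with rfl | ha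
      · simp
      · rw [hR a ha]
        ring
  rw [hquad f hf, hw]
  ring

end SphericalDesign

end

/-! ### The upper energy bound -/

theorem mainTheorem3 (n k M : ℕ) (hn : 3 ≤ n) (hk : 1 ≤ k)
    (h : ℝ → ℝ≥0∞) (hh : SphericalDesign.AbsMonotone h)
    (s u : ℝ) (hu : u ∈ Set.Ico (-1 : ℝ) 1) (g : ℝ[X]) :
    -- the case `τ = 2k - 1`
    (SphericalDesign.dgs n (2 * k - 1) < M → M < SphericalDesign.dgs n (2 * k) →
      s ∈ Set.Icc (SphericalDesign.lastRoot n 1 1 (k - 1)) (SphericalDesign.lastRoot n 1 0 k) →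
      SphericalDesign.levOdd n k s = M →
      SphericalDesign.maxInner n M (2 * k - 1) ≤ (u : EReal) →
      g.natDegree ≤ 2 * k - 1 →
      SphericalDesign.Interpolates h {-1, u} (SphericalDesign.adjRoots n 1 1 (k - 1)) g →
      SphericalDesign.maxEnergy n M (2 * k - 1) h / ((M : EReal) ^ 2) ≤
        ((SphericalDesign.ulb n M (SphericalDesign.nodesOdd n k s) h / (M : ℝ) ^ 2
          + ∑ a ∈ SphericalDesign.nodesOdd n k s,
              SphericalDesign.weight n (SphericalDesign.nodesOdd n k s) a
                * (g.eval a - (h a).toReal) : ℝ) : EReal)) ∧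
    -- the case `τ = 2k`
    (SphericalDesign.dgs n (2 * k) < M → M < SphericalDesign.dgs n (2 * k + 1) →
      s ∈ Set.Icc (SphericalDesign.lastRoot n 1 0 k) (SphericalDesign.lastRoot n 1 1 k) →
      SphericalDesign.levEven n k s = M →
      SphericalDesign.maxInner n M (2 * k) ≤ (u : EReal) →
      g.natDegree ≤ 2 * k →
      SphericalDesign.Interpolates h {u} (SphericalDesign.adjRoots n 1 0 k) g →
      SphericalDesign.maxEnergy n M (2 * k) h / ((M : EReal) ^ 2) ≤
        ((SphericalDesign.ulb n M (SphericalDesign.nodesEven n k s) h / (M : ℝ) ^ 2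
          + ∑ b ∈ SphericalDesign.nodesEven n k s,
              SphericalDesign.weight n (SphericalDesign.nodesEven n k s) b
                * (g.eval b - (h b).toReal) : ℝ) : EReal)) := by
  constructor
  · obtain ⟨m, rfl⟩ : ∃ m, k = m + 1 := ⟨k - 1, by lia⟩
    rw [show 2 * (m + 1) - 1 = 2 * m + 1 by lia, Nat.add_sub_cancel]
    intro hM _ _ hs hmax hg hi
    refine SphericalDesign.maxEnergy_div_le_of_quadrature hn (by lia) hh hu.2 hmax hg
      (SphericalDesign.quadrature_nodesOdd hn hM hs hg) fun D hD hc hpair t ht => ?_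
    rw [← hc] at hM
    -- The size of the design makes `-1`, `u` and the zeros of `P_m^{1,1}` distinct: `2m + 2`
    -- conditions with multiplicity, one more than the degree bound on `g`.
    have hu1 := hD.ne_neg_one hn hM hpair
    have huT := hD.notMem_adjRoots_one_one hn hM hu.2 hpair
    have hT : ∀ x ∈ SphericalDesign.adjRoots n 1 1 m, x ∈ Set.Ioo (-1 : ℝ) 1 :=
      fun x hx => SphericalDesign.adjRoots_one_one_mem_Ioo hn m hx
    have hcard : ({-1, u} : Finset ℝ).card = 2 := Finset.card_pair hu1.symm
    obtain ⟨κ, hκ, he⟩ := hh.exists_sub_eq_mul_hermiteNodal (S := {-1, u})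
      (T := SphericalDesign.adjRoots n 1 1 m) (Finset.insert_nonempty _ _)
      (by
        intro x hx
        rcases Finset.mem_insert.1 hx with rfl | hx
        · norm_num
        · rw [Finset.mem_singleton.1 hx]
          exact hu)
      hT
      (by
        rw [Finset.disjoint_left]
        intro x hx hxT
        rcases Finset.mem_insert.1 hx with rfl | hx
        · exact (hT _ hxT).1.false
        · rw [Finset.mem_singleton.1 hx] at hxT
          exact huT hxT)
      (by rw [hcard, SphericalDesign.card_adjRoots_one_one hn]; lia) hi
      (t := t) ⟨ht.1, ht.2.trans_lt hu.2⟩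
    -- On `[-1, u]` the factor `(t + 1)(t - u)` is nonpositive and the double nodes contribute a
    -- square.
    have hω : (SphericalDesign.hermiteNodal {-1, u} (SphericalDesign.adjRoots n 1 1 m)).eval t
        ≤ 0 := by
      rw [SphericalDesign.hermiteNodal, eval_mul, eval_pow, Lagrange.eval_nodal,
        Finset.prod_pair hu1.symm]
      refine mul_nonpos_of_nonpos_of_nonneg ?_ (sq_nonneg _)
      exact mul_nonpos_of_nonneg_of_nonpos (by simp only [id_eq]; linarith [ht.1])
        (by simp only [id_eq]; linarith [ht.2])
    linarith [mul_nonpos_of_nonneg_of_nonpos hκ hω]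
  · intro hM _ _ hs hmax hg hi
    obtain ⟨m, rfl⟩ : ∃ m, k = m + 1 := ⟨k - 1, by lia⟩
    refine SphericalDesign.maxEnergy_div_le_of_quadrature hn (by lia) hh hu.2 hmax hg
      (SphericalDesign.quadrature_nodesEven hn hM hs hg) fun D hD hc hpair t ht => ?_
    rw [← hc] at hM
    -- Here the only simple node is `u`; the double nodes, zeros of `P_{m+1}^{1,0}`, bring the count
    -- to `2(m + 1) + 1`.
    have huT := hD.notMem_adjRoots_one_zero hn hM hu.2 hpair
    obtain ⟨κ, hκ, he⟩ := hh.exists_sub_eq_mul_hermiteNodal (S := {u})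
      (T := SphericalDesign.adjRoots n 1 0 (m + 1)) (Finset.singleton_nonempty u)
      (by
        intro x hx
        rw [Finset.mem_singleton.1 hx]
        exact hu)
      (fun x hx => SphericalDesign.adjRoots_one_zero_mem_Ioo hn (m + 1) hx)
      (Finset.disjoint_singleton_left.2 huT)
      (by rw [Finset.card_singleton, SphericalDesign.card_adjRoots_one_zero hn]; lia) hi
      (t := t) ⟨ht.1, ht.2.trans_lt hu.2⟩
    have hω : (SphericalDesign.hermiteNodal {u} (SphericalDesign.adjRoots n 1 0 (m + 1))).eval t
        ≤ 0 := by
      rw [SphericalDesign.hermiteNodal, eval_mul, eval_pow, Lagrange.eval_nodal,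
        Finset.prod_singleton]
      refine mul_nonpos_of_nonpos_of_nonneg ?_ (sq_nonneg _)
      simp only [id_eq]
      linarith [ht.2]
    linarith [mul_nonpos_of_nonneg_of_nonpos hκ hω]
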